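/- **Conventions.** "Countable" means at most countable. A $0$-lattice is a lattice with a least element $0$, and a $0$-lattice homomorphism is a lattice homomorphism preserving $0$. A distributive $0$-lattice $L$ is *completely normal* if for all $a,b\in L$ there are $u,v\in L$ with $a\le u\vee b$, $b\le a\vee v$ and $u\wedge v=0$. Let $\Bbbk$ be a totally ordered division ring. For a set $I$, let $\Bbbk^{(I)}$ be the set of all finitely supported families $(x_i)_{i\in I}$ of elements of $\Bbbk$; each $a\in\Bbbk^{(I)}$ defines the functional $x\mapsto a(x)=\sum_{i\in I}a_ix_i$ on $\Bbbk^{(I)}$. Let $\mathrm{Op}^-(\Bbbk^{(I)},\Bbbk^{(I)})$ be the sublattice of the powerset of $\Bbbk^{(I)}$ generated by all sets $\{x: a(x)>0\}$ and $\{x: a(x)<0\}$ with $a\in\Bbbk^{(I)}$; its least element is $\varnothing$. For $I\subseteq J$, let $\varepsilon_{I,J}\colon\mathrm{Op}^-(\Bbbk^{(I)},\Bbbk^{(I)})\to\mathrm{Op}^-(\Bbbk^{(J)},\Bbbk^{(J)})$ be the lattice homomorphism $X\mapsto\{y\in\Bbbk^{(J)}: y|_I\in X\}$. A left $\Bbbk$-vector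 lattice is a left $\Bbbk$-vector space that is a lattice-ordered Abelian group in which multiplication by nonnegative scalars is isotone; an $\ell$-ideal of it is an order-convex vector subspace closed under $\vee$ and $\wedge$; $\mathrm{Id}_c V$ is the $0$-lattice of all principal $\ell$-ideals $\langle a\rangle$ of $V$ (that is, $\ell$-ideals generated by a single element $a$), ordered by inclusion. Let $\mathrm{F}_\ell(I,\Bbbk)$ be the free left $\Bbbk$-vector lattice on $I$ and, for $I\subseteq J$, let $\eta_{I,J}\colon\mathrm{Id}_c\mathrm{F}_\ell(I,\Bbbk)\to\mathrm{Id}_c\mathrm{F}_\ell(J,\Bbbk)$, $\langle a\rangle\mapsto\langle\iota(a)\rangle$, where $\iota\colon\mathrm{F}_\ell(I,\Bbbk)\to\mathrm{F}_\ell(J,\Bbbk)$ is the vector lattice homomorphism sending each generator $i\in I$ to the generator $i$. **Theorem.** Let $\Bbbk$ be a countable totally ordered division ring, let $I$ and $J$ be countable sets with $I\subset J$ and $J\setminus I$ infinite, let $K$ and $L$ be distributive $0$-lattices with $L$ countable and completely normal, and let $\varphi\colon K\to L$ be a $0$-lattice homomorphism. 1. For every $0$-lattice homomorphism $f\colon\mathrm{Op}^-(\Bbbk^{(I)},\Bbbk^{(I)})\to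 K$ there exists a surjective lattice homomorphism $g\colon\mathrm{Op}^-(\Bbbk^{(J)},\Bbbk^{(J)})\to L$ such that $g\circ\varepsilon_{I,J}=\varphi\circ f$. 2. For every $0$-lattice homomorphism $f\colon\mathrm{Id}_c\mathrm{F}_\ell(I,\Bbbk)\to K$ there exists a surjective lattice homomorphism $g\colon\mathrm{Id}_c\mathrm{F}_\ell(J,\Bbbk)\to L$ such that $g\circ\eta_{I,J}=\varphi\circ f$. -/

import Mathlib

/-! ### Completely normal lattices -/

/-- A lattice with bottom element is completely normal if any two of its elements `a`, `b` are
consonant: `a ≤ u ⊔ b`, `b ≤ a ⊔ v` and `u ⊓ v = ⊥` for some `u`, `v`. -/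
def CompletelyNormal (L : Type*) [Lattice L] [OrderBot L] : Prop :=
  ∀ a b : L, ∃ u v : L, a ≤ u ⊔ b ∧ b ≤ a ⊔ v ∧ u ⊓ v = ⊥

/-! ### The lattices `Op⁻` -/

section OpMinus

/-- `Op⁻(F, Ω)`: the sublattice of the powerset of `Ω` generated by all sets `{x | f x > 0}` and
`{x | f x < 0}` for `f ∈ F`. -/
def OpMinus {k Ω : Type*} [Zero k] [LT k] (F : Set (Ω → k)) : Sublattice (Set Ω) :=
  Sublattice.ofIsSublattice
    (latticeClosure {U : Set Ω | ∃ f ∈ F, U = {x | 0 < f x} ∨ U = {x | f x < 0}})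
    isSublattice_latticeClosure

/-- The linear functional `x ↦ ∑ i, a i * x i` on the right vector space `k^(I)` given by an element
`a` of the left vector space `k^(I)`. -/
noncomputable def linFunctional {k I : Type*} [DivisionRing k] (a x : I →₀ k) : k :=
  a.sum fun i c => c * x i

variable (k : Type*) [DivisionRing k] [LinearOrder k]

/-- `Op⁻(k^(I), k^(I))`. -/
def OpSpace (I : Type*) : Sublattice (Set (I →₀ k)) :=
  OpMinus (Set.range (linFunctional (k := k) (I := I)))

variable {k} in
theorem empty_mem_opSpace (I : Type*) : (∅ : Set (I →₀ k)) ∈ OpSpace k I := by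
  refine subset_latticeClosure ⟨linFunctional 0, ⟨0, rfl⟩, Or.inl ?_⟩
  ext x
  simp [linFunctional]

instance OpSpace.instOrderBot (I : Type*) : OrderBot (OpSpace k I) where
  bot := ⟨∅, empty_mem_opSpace I⟩
  bot_le X := Set.empty_subset (X : Set (I →₀ k))

variable {J : Type*} (I : Set J)

/-- `ε_{I,J}` on powersets: the set of all `y ∈ k^(J)` whose restriction to `I` is in `X`. -/
def epsSet (X : Set (I →₀ k)) : Set (J →₀ k) :=
  {y | y.subtypeDomain (· ∈ I) ∈ X}

variable {k}

theorem linFunctional_mapDomain (a : I →₀ k) (y : J →₀ k) :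
    linFunctional (a.mapDomain Subtype.val) y = linFunctional a (y.subtypeDomain (· ∈ I)) := by
  unfold linFunctional
  rw [Finsupp.sum_mapDomain_index (by simp) (by intros; rw [add_mul])]
  rfl

theorem epsSet_mem {X : Set (I →₀ k)} (hX : X ∈ OpSpace k I) : epsSet k I X ∈ OpSpace k J := by
  have key : latticeClosure {U : Set (I →₀ k) |
      ∃ f ∈ Set.range (linFunctional (k := k) (I := I)), U = {x | 0 < f x} ∨ U = {x | f x < 0}} ⊆
      {X : Set (I →₀ k) | epsSet k I X ∈ OpSpace k J} := by
    refine latticeClosure_min ?_ ⟨?_, ?_⟩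
    · rintro U ⟨_, ⟨a, rfl⟩, hU⟩
      refine subset_latticeClosure
        ⟨linFunctional (a.mapDomain Subtype.val), ⟨_, rfl⟩, ?_⟩
      rcases hU with rfl | rfl
      · left; ext y; simp only [epsSet, Set.mem_ofPred_eq, linFunctional_mapDomain]
      · right; ext y; simp only [epsSet, Set.mem_ofPred_eq, linFunctional_mapDomain]
    · intro A hA B hB
      exact (OpSpace k J).sup_mem hA hB
    · intro A hA B hB
      exact (OpSpace k J).inf_mem hA hB
  exact key hX

variable (k)

/-- `ε_{I,J}` as a lattice homomorphism from `Op⁻(k^(I), k^(I))` to `Op⁻(k^(J), k^(J))`. -/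
def eps : LatticeHom (OpSpace k I) (OpSpace k J) where
  toFun X := ⟨epsSet k I X, epsSet_mem I X.2⟩
  map_sup' _ _ := rfl
  map_inf' _ _ := rfl

end OpMinus

/-! ### Vector lattices and their principal `ℓ`-ideals

A (left) `k`-vector lattice is a left `k`-module `V` which is a lattice-ordered abelian group in
which multiplication by nonnegative scalars is monotone. -/

section VectorLattice

variable {k : Type*} [DivisionRing k] [LinearOrder k] [IsStrictOrderedRing k]
variable {V : Type*} [AddCommGroup V] [Lattice V] [IsOrderedAddMonoid V] [Module k V]
  [PosSMulMono k V]

theorem VectorLattice.posSMulReflectLE : PosSMulReflectLE k V where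
  le_of_smul_le_smul_left c hc x y h := by
    have := smul_le_smul_of_nonneg_left h (inv_nonneg.2 hc.le)
    rwa [inv_smul_smul₀ hc.ne', inv_smul_smul₀ hc.ne'] at this

theorem VectorLattice.smul_sup {c : k} (hc : 0 ≤ c) (x y : V) :
    c • (x ⊔ y) = c • x ⊔ c • y := by
  rcases hc.eq_or_lt with rfl | hc
  · simp
  · have := VectorLattice.posSMulReflectLE (k := k) (V := V)
    exact (OrderIso.smulRight (β := V) hc).map_sup x y

theorem VectorLattice.smul_inf {c : k} (hc : 0 ≤ c) (x y : V) :
    c • (x ⊓ y) = c • x ⊓ c • y := by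
  rcases hc.eq_or_lt with rfl | hc
  · simp
  · have := VectorLattice.posSMulReflectLE (k := k) (V := V)
    exact (OrderIso.smulRight (β := V) hc).map_inf x y

theorem VectorLattice.smul_le_smul_right {c d : k} (h : c ≤ d) {x : V} (hx : 0 ≤ x) :
    c • x ≤ d • x := by
  have : 0 ≤ (d - c) • x := smul_nonneg (sub_nonneg.2 h) hx
  rwa [sub_smul, sub_nonneg] at this

theorem VectorLattice.abs_smul_le (c : k) (x : V) : |c • x| ≤ |c| • |x| := by
  have h : ∀ y : V, c • y ≤ |c| • |y| := by
    intro y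
    rcases le_total 0 c with hc | hc
    · rw [abs_of_nonneg hc]
      exact smul_le_smul_of_nonneg_left (le_abs_self y) hc
    · rw [abs_of_nonpos hc, ← neg_smul_neg c y]
      exact smul_le_smul_of_nonneg_left (neg_le_abs y) (neg_nonneg.2 hc)
  refine abs_le'.2 ⟨h x, ?_⟩
  have := h (-x)
  rwa [smul_neg, abs_neg] at this

/-- An `ℓ`-ideal of a `k`-vector lattice: an order-convex vector subspace closed under the lattice
operations. -/
structure IsLIdeal (S : Submodule k V) : Prop where
  convex : ∀ ⦃x y z : V⦄, x ∈ S → z ∈ S → x ≤ y → y ≤ z → y ∈ S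
  sup_mem : ∀ ⦃x y : V⦄, x ∈ S → y ∈ S → x ⊔ y ∈ S
  inf_mem : ∀ ⦃x y : V⦄, x ∈ S → y ∈ S → x ⊓ y ∈ S

variable (k) in
/-- The principal `ℓ`-ideal `⟨a⟩`; it is the least `ℓ`-ideal containing `a`, see
`principalLIdeal_isLeast`. -/
def principalLIdeal (a : V) : Submodule k V where
  carrier := {x | ∃ c : k, 0 ≤ c ∧ |x| ≤ c • |a|}
  add_mem' := by
    rintro x y ⟨c, hc, hx⟩ ⟨d, hd, hy⟩
    refine ⟨c + d, add_nonneg hc hd, (abs_add_le x y).trans ?_⟩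
    rw [add_smul]
    exact add_le_add hx hy
  zero_mem' := ⟨0, le_rfl, by simp⟩
  smul_mem' := by
    rintro r x ⟨c, hc, hx⟩
    refine ⟨|r| * c, mul_nonneg (abs_nonneg r) hc, (VectorLattice.abs_smul_le r x).trans ?_⟩
    rw [mul_smul]
    exact smul_le_smul_of_nonneg_left hx (abs_nonneg r)

theorem mem_principalLIdeal {a x : V} :
    x ∈ principalLIdeal k a ↔ ∃ c : k, 0 ≤ c ∧ |x| ≤ c • |a| := Iff.rfl

theorem self_mem_principalLIdeal (a : V) : a ∈ principalLIdeal k a :=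
  ⟨1, zero_le_one, by simp⟩

theorem IsLIdeal.abs_mem {S : Submodule k V} (hS : IsLIdeal S) {x : V} (hx : x ∈ S) : |x| ∈ S :=
  hS.sup_mem hx (S.neg_mem hx)

theorem IsLIdeal.mem_of_abs_le {S : Submodule k V} (hS : IsLIdeal S) {x y : V} (hy : y ∈ S)
    (h : |x| ≤ y) : x ∈ S :=
  hS.convex (S.neg_mem hy) hy (neg_le.1 ((neg_le_abs x).trans h)) ((le_abs_self x).trans h)

theorem principalLIdeal_isLIdeal (a : V) : IsLIdeal (principalLIdeal k a) := by
  have bound : ∀ {x y z : V}, x ∈ principalLIdeal k a → z ∈ principalLIdeal k a →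
      |y| ≤ |x| + |z| → y ∈ principalLIdeal k a := by
    rintro x y z ⟨c, hc, hx⟩ ⟨d, hd, hz⟩ h
    refine ⟨c + d, add_nonneg hc hd, h.trans ?_⟩
    rw [add_smul]
    exact add_le_add hx hz
  have h1 : ∀ u v : V, u ≤ |u| + |v| := fun u v =>
    (le_abs_self u).trans (le_add_of_nonneg_right (abs_nonneg v))
  have h2 : ∀ u v : V, v ≤ |u| + |v| := fun u v =>
    (le_abs_self v).trans (le_add_of_nonneg_left (abs_nonneg u))
  have h3 : ∀ u v : V, -u ≤ |u| + |v| := fun u v => by simpa using h1 (-u) (-v)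
  have h4 : ∀ u v : V, -v ≤ |u| + |v| := fun u v => by simpa using h2 (-u) (-v)
  refine ⟨?_, ?_, ?_⟩
  · intro x y z hx hz hxy hyz
    exact bound hx hz (abs_le'.2 ⟨hyz.trans (h2 x z), (neg_le_neg hxy).trans (h3 x z)⟩)
  · intro x y hx hy
    refine bound hx hy (abs_le'.2 ⟨sup_le (h1 x y) (h2 x y), ?_⟩)
    exact (neg_le_neg le_sup_left).trans (h3 x y)
  · intro x y hx hy
    refine bound hx hy (abs_le'.2 ⟨inf_le_left.trans (h1 x y), ?_⟩)
    rw [neg_inf]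
    exact sup_le (h3 x y) (h4 x y)

theorem IsLIdeal.principal_le {S : Submodule k V} (hS : IsLIdeal S) {a : V} (ha : a ∈ S) :
    principalLIdeal k a ≤ S := by
  rintro x ⟨c, _, hx⟩
  exact hS.mem_of_abs_le (S.smul_mem c (hS.abs_mem ha)) hx

theorem principalLIdeal_isLeast (a : V) :
    IsLeast {S : Submodule k V | IsLIdeal S ∧ a ∈ S} (principalLIdeal k a) :=
  ⟨⟨principalLIdeal_isLIdeal a, self_mem_principalLIdeal a⟩, fun _ hS => hS.1.principal_le hS.2⟩

theorem principalLIdeal_le_iff {a b : V} :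
    principalLIdeal k a ≤ principalLIdeal k b ↔ a ∈ principalLIdeal k b :=
  ⟨fun h => h (self_mem_principalLIdeal a), fun h => (principalLIdeal_isLIdeal b).principal_le h⟩

theorem principalLIdeal_sup (a b : V) :
    principalLIdeal k a ⊔ principalLIdeal k b = principalLIdeal k (|a| + |b|) := by
  have hab : |(|a| + |b|)| = |a| + |b| := abs_of_nonneg (add_nonneg (abs_nonneg a) (abs_nonneg b))
  apply le_antisymm
  · refine sup_le (principalLIdeal_le_iff.2 ⟨1, zero_le_one, ?_⟩)
      (principalLIdeal_le_iff.2 ⟨1, zero_le_one, ?_⟩)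
    · rw [hab, one_smul]; exact le_add_of_nonneg_right (abs_nonneg b)
    · rw [hab, one_smul]; exact le_add_of_nonneg_left (abs_nonneg a)
  · have pos : ∀ y : V, 0 ≤ y → y ∈ principalLIdeal k (|a| + |b|) →
        y ∈ principalLIdeal k a ⊔ principalLIdeal k b := by
      rintro y hy ⟨c, hc, h⟩
      rw [hab, abs_of_nonneg hy, smul_add] at h
      have hca : 0 ≤ c • |a| := smul_nonneg hc (abs_nonneg a)
      have hcb : 0 ≤ c • |b| := smul_nonneg hc (abs_nonneg b)
      have hd : 0 ≤ y - y ⊓ c • |a| := sub_nonneg.2 inf_le_left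
      refine Submodule.mem_sup.2 ⟨y ⊓ c • |a|, ⟨c, hc, ?_⟩, y - y ⊓ c • |a|, ⟨c, hc, ?_⟩, by abel⟩
      · rw [abs_of_nonneg (le_inf hy hca)]; exact inf_le_right
      · rw [abs_of_nonneg hd, sub_le_comm]
        refine le_inf (sub_le_self y hcb) ?_
        rwa [sub_le_iff_le_add]
    intro x hx
    have hI := principalLIdeal_isLIdeal (k := k) (|a| + |b|)
    have e : x = (x ⊔ 0) - (-x ⊔ 0) := (posPart_sub_negPart x).symm
    rw [e]
    exact Submodule.sub_mem _ (pos _ le_sup_right (hI.sup_mem hx (Submodule.zero_mem _)))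
      (pos _ le_sup_right (hI.sup_mem (Submodule.neg_mem _ hx) (Submodule.zero_mem _)))

theorem principalLIdeal_inf (a b : V) :
    principalLIdeal k a ⊓ principalLIdeal k b = principalLIdeal k (|a| ⊓ |b|) := by
  have hab : |(|a| ⊓ |b|)| = |a| ⊓ |b| := abs_of_nonneg (le_inf (abs_nonneg a) (abs_nonneg b))
  apply le_antisymm
  · rintro x ⟨⟨c, hc, hx⟩, ⟨d, hd, hx'⟩⟩
    refine ⟨max c d, hc.trans (le_max_left c d), ?_⟩
    rw [hab, VectorLattice.smul_inf (hc.trans (le_max_left c d))]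
    exact le_inf (hx.trans (VectorLattice.smul_le_smul_right (le_max_left c d) (abs_nonneg a)))
      (hx'.trans (VectorLattice.smul_le_smul_right (le_max_right c d) (abs_nonneg b)))
  · refine le_inf (principalLIdeal_le_iff.2 ⟨1, zero_le_one, ?_⟩)
      (principalLIdeal_le_iff.2 ⟨1, zero_le_one, ?_⟩)
    · rw [hab, one_smul]; exact inf_le_left
    · rw [hab, one_smul]; exact inf_le_right

variable (k V) in
/-- `Id_c V`: the lattice, under inclusion, of all principal `ℓ`-ideals of the `k`-vector lattice
`V`. -/
def Idc : Sublattice (Submodule k V) where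
  carrier := Set.range (principalLIdeal k)
  supClosed' := by
    rintro _ ⟨a, rfl⟩ _ ⟨b, rfl⟩
    exact ⟨_, (principalLIdeal_sup a b).symm⟩
  infClosed' := by
    rintro _ ⟨a, rfl⟩ _ ⟨b, rfl⟩
    exact ⟨_, (principalLIdeal_inf a b).symm⟩

variable (k) in
/-- The principal `ℓ`-ideal `⟨a⟩` as an element of `Id_c V`. -/
def Idc.mk (a : V) : Idc k V := ⟨principalLIdeal k a, a, rfl⟩

theorem Idc.exists_mk (S : Idc k V) : ∃ a : V, Idc.mk k a = S :=
  ⟨S.2.choose, Subtype.ext S.2.choose_spec⟩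

theorem Idc.mk_le_mk {a b : V} :
    Idc.mk k a ≤ Idc.mk k b ↔ ∃ c : k, 0 ≤ c ∧ |a| ≤ c • |b| :=
  principalLIdeal_le_iff

theorem Idc.mk_sup_mk (a b : V) : Idc.mk k a ⊔ Idc.mk k b = Idc.mk k (|a| + |b|) :=
  Subtype.ext (principalLIdeal_sup a b)

theorem Idc.mk_inf_mk (a b : V) : Idc.mk k a ⊓ Idc.mk k b = Idc.mk k (|a| ⊓ |b|) :=
  Subtype.ext (principalLIdeal_inf a b)

instance Idc.instOrderBot : OrderBot (Idc k V) where
  bot := Idc.mk k 0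
  bot_le S := by
    obtain ⟨a, rfl⟩ := (Idc.exists_mk S)
    exact Idc.mk_le_mk.2 ⟨0, le_rfl, by simp⟩

variable (k V) in
/-- A homomorphism of `k`-vector lattices. -/
structure VectorLatticeHom (W : Type*) [AddCommGroup W] [Lattice W] [Module k W]
    extends V →ₗ[k] W where
  map_sup' : ∀ x y : V, toFun (x ⊔ y) = toFun x ⊔ toFun y
  map_inf' : ∀ x y : V, toFun (x ⊓ y) = toFun x ⊓ toFun y

variable {W : Type*} [AddCommGroup W] [Lattice W] [IsOrderedAddMonoid W] [Module k W]
  [PosSMulMono k W]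

theorem VectorLatticeHom.map_abs (h : VectorLatticeHom k V W) (x : V) :
    h.toLinearMap |x| = |h.toLinearMap x| := by
  have := h.map_sup' x (-x)
  change h.toLinearMap (x ⊔ -x) = h.toLinearMap x ⊔ h.toLinearMap (-x) at this
  rw [map_neg] at this
  exact this

theorem VectorLatticeHom.mono (h : VectorLatticeHom k V W) {x y : V} (hxy : x ≤ y) :
    h.toLinearMap x ≤ h.toLinearMap y := by
  have := h.map_sup' x y
  rw [sup_eq_right.2 hxy] at this
  exact sup_eq_right.1 this.symm

theorem VectorLatticeHom.mk_mono (h : VectorLatticeHom k V W) {a b : V}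
    (hab : Idc.mk k a ≤ Idc.mk k b) :
    Idc.mk k (h.toLinearMap a) ≤ Idc.mk k (h.toLinearMap b) := by
  obtain ⟨c, hc, hle⟩ := Idc.mk_le_mk.1 hab
  refine Idc.mk_le_mk.2 ⟨c, hc, ?_⟩
  have := h.mono hle
  rwa [map_smul, h.map_abs, h.map_abs] at this

/-- The underlying map of `Id_c h` for a homomorphism `h` of vector lattices, namely
`⟨a⟩ ↦ ⟨h a⟩`, see `idcMapFun_mk`. -/
noncomputable def idcMapFun (h : VectorLatticeHom k V W) (S : Idc k V) : Idc k W :=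
  Idc.mk k (h.toLinearMap (Idc.exists_mk S).choose)

theorem idcMapFun_mk (h : VectorLatticeHom k V W) (a : V) :
    idcMapFun h (Idc.mk k a) = Idc.mk k (h.toLinearMap a) :=
  le_antisymm (h.mk_mono (Idc.exists_mk (Idc.mk k a)).choose_spec.le)
    (h.mk_mono (Idc.exists_mk (Idc.mk k a)).choose_spec.ge)

/-- `Id_c h`, as a lattice homomorphism. -/
noncomputable def idcMap (h : VectorLatticeHom k V W) : LatticeHom (Idc k V) (Idc k W) where
  toFun := idcMapFun h
  map_sup' S T := by
    obtain ⟨a, rfl⟩ := (Idc.exists_mk S)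
    obtain ⟨b, rfl⟩ := (Idc.exists_mk T)
    rw [Idc.mk_sup_mk, idcMapFun_mk, idcMapFun_mk, idcMapFun_mk, Idc.mk_sup_mk, map_add,
      h.map_abs, h.map_abs]
  map_inf' S T := by
    obtain ⟨a, rfl⟩ := (Idc.exists_mk S)
    obtain ⟨b, rfl⟩ := (Idc.exists_mk T)
    have := h.map_inf' |a| |b|
    change h.toLinearMap (|a| ⊓ |b|) = h.toLinearMap |a| ⊓ h.toLinearMap |b| at this
    rw [Idc.mk_inf_mk, idcMapFun_mk, idcMapFun_mk, idcMapFun_mk, Idc.mk_inf_mk, this,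
      h.map_abs, h.map_abs]

theorem idcMap_mk (h : VectorLatticeHom k V W) (a : V) :
    idcMap h (Idc.mk k a) = Idc.mk k (h.toLinearMap a) :=
  idcMapFun_mk h a

end VectorLattice

/-! ### The free `k`-vector lattice on a set -/

/-- Terms in the language of `k`-vector lattices, with variables in `X`. -/
inductive VLTerm (k X : Type*) where
  | of : X → VLTerm k X
  | zero : VLTerm k X
  | add : VLTerm k X → VLTerm k X → VLTerm k X
  | neg : VLTerm k X → VLTerm k X
  | smul : k → VLTerm k X → VLTerm k X
  | sup : VLTerm k X → VLTerm k X → VLTerm k X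
  | inf : VLTerm k X → VLTerm k X → VLTerm k X

namespace VLTerm

/-- The least congruence on terms containing all instances of the axioms of `k`-vector lattices. -/
inductive Rel {k X : Type*} [DivisionRing k] [LinearOrder k] : VLTerm k X → VLTerm k X → Prop
  | refl (a) : Rel a a
  | symm {a b} : Rel a b → Rel b a
  | trans {a b c} : Rel a b → Rel b c → Rel a c
  | add_congr {a a' b b'} : Rel a a' → Rel b b' → Rel (add a b) (add a' b')
  | neg_congr {a a'} : Rel a a' → Rel (neg a) (neg a')
  | smul_congr (r) {a a'} : Rel a a' → Rel (smul r a) (smul r a')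
  | sup_congr {a a' b b'} : Rel a a' → Rel b b' → Rel (sup a b) (sup a' b')
  | inf_congr {a a' b b'} : Rel a a' → Rel b b' → Rel (inf a b) (inf a' b')
  | add_assoc (a b c) : Rel (add (add a b) c) (add a (add b c))
  | add_comm (a b) : Rel (add a b) (add b a)
  | zero_add (a) : Rel (add zero a) a
  | neg_add (a) : Rel (add (neg a) a) zero
  | one_smul (a) : Rel (smul 1 a) a
  | mul_smul (r s a) : Rel (smul (r * s) a) (smul r (smul s a))
  | smul_add (r a b) : Rel (smul r (add a b)) (add (smul r a) (smul r b))
  | add_smul (r s a) : Rel (smul (r + s) a) (add (smul r a) (smul s a))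
  | sup_comm (a b) : Rel (sup a b) (sup b a)
  | sup_assoc (a b c) : Rel (sup (sup a b) c) (sup a (sup b c))
  | inf_comm (a b) : Rel (inf a b) (inf b a)
  | inf_assoc (a b c) : Rel (inf (inf a b) c) (inf a (inf b c))
  | sup_inf_self (a b) : Rel (sup a (inf a b)) a
  | inf_sup_self (a b) : Rel (inf a (sup a b)) a
  | add_sup (a b c) : Rel (add a (sup b c)) (sup (add a b) (add a c))
  | smul_sup (r) (hr : 0 ≤ r) (a b) : Rel (smul r (sup a b)) (sup (smul r a) (smul r b))

/-- The value of a term in a vector lattice, at a given assignment of the variables. -/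
def eval {k X V : Type*} [DivisionRing k] [AddCommGroup V] [Lattice V] [Module k V] (v : X → V) :
    VLTerm k X → V
  | of x => v x
  | zero => 0
  | add a b => eval v a + eval v b
  | neg a => -eval v a
  | smul r a => r • eval v a
  | sup a b => eval v a ⊔ eval v b
  | inf a b => eval v a ⊓ eval v b

variable {k X V : Type*} [DivisionRing k] [LinearOrder k]

theorem Rel.eval_eq [IsStrictOrderedRing k] [AddCommGroup V] [Lattice V] [IsOrderedAddMonoid V]
    [Module k V] [PosSMulMono k V] (v : X → V) {a b : VLTerm k X} (h : Rel a b) :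
    eval v a = eval v b := by
  induction h with
  | refl => rfl
  | symm _ ih => exact ih.symm
  | trans _ _ ih₁ ih₂ => exact ih₁.trans ih₂
  | add_congr _ _ ih₁ ih₂ => simp only [eval, ih₁, ih₂]
  | neg_congr _ ih => simp only [eval, ih]
  | smul_congr _ _ ih => simp only [eval, ih]
  | sup_congr _ _ ih₁ ih₂ => simp only [eval, ih₁, ih₂]
  | inf_congr _ _ ih₁ ih₂ => simp only [eval, ih₁, ih₂]
  | add_assoc => exact _root_.add_assoc _ _ _
  | add_comm => exact _root_.add_comm _ _
  | zero_add => exact _root_.zero_add _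
  | neg_add => exact neg_add_cancel _
  | one_smul => exact _root_.one_smul _ _
  | mul_smul => exact SemigroupAction.mul_smul _ _ _
  | smul_add => exact _root_.smul_add _ _ _
  | add_smul => exact _root_.add_smul _ _ _
  | sup_comm => exact _root_.sup_comm _ _
  | sup_assoc => exact _root_.sup_assoc _ _ _
  | inf_comm => exact _root_.inf_comm _ _
  | inf_assoc => exact _root_.inf_assoc _ _ _
  | sup_inf_self => exact _root_.sup_inf_self
  | inf_sup_self => exact _root_.inf_sup_self
  | add_sup => exact _root_.add_sup _ _ _
  | smul_sup r hr => exact VectorLattice.smul_sup hr _ _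

/-- The setoid of provable equality of terms. -/
def setoid (k X : Type*) [DivisionRing k] [LinearOrder k] : Setoid (VLTerm k X) :=
  ⟨Rel, Rel.refl, Rel.symm, Rel.trans⟩

end VLTerm

/-- `F_ℓ(X, k)`: the free left `k`-vector lattice on `X`. -/
def FreeVL (k X : Type*) [DivisionRing k] [LinearOrder k] : Type _ :=
  Quotient (VLTerm.setoid k X)

namespace FreeVL

section Instances

variable {k X : Type*} [DivisionRing k] [LinearOrder k]

open VLTerm (Rel)

/-- The canonical generators. -/
def of (x : X) : FreeVL k X := Quotient.mk (VLTerm.setoid k X) (VLTerm.of x)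

instance : Zero (FreeVL k X) := ⟨Quotient.mk (VLTerm.setoid k X) VLTerm.zero⟩

instance : Add (FreeVL k X) :=
  ⟨Quotient.map₂ VLTerm.add fun _ _ h _ _ h' => Rel.add_congr h h'⟩

instance : Neg (FreeVL k X) := ⟨Quotient.map VLTerm.neg fun _ _ h => Rel.neg_congr h⟩

instance : SMul k (FreeVL k X) :=
  ⟨fun r => Quotient.map (VLTerm.smul r) fun _ _ h => Rel.smul_congr r h⟩

instance : AddCommGroup (FreeVL k X) where
  add_assoc := by
    rintro ⟨a⟩ ⟨b⟩ ⟨c⟩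
    exact Quotient.sound (Rel.add_assoc a b c)
  zero_add := by
    rintro ⟨a⟩
    exact Quotient.sound (Rel.zero_add a)
  add_zero := by
    rintro ⟨a⟩
    exact Quotient.sound ((Rel.add_comm a _).trans (Rel.zero_add a))
  neg_add_cancel := by
    rintro ⟨a⟩
    exact Quotient.sound (Rel.neg_add a)
  add_comm := by
    rintro ⟨a⟩ ⟨b⟩
    exact Quotient.sound (Rel.add_comm a b)
  nsmul := nsmulRec
  zsmul := zsmulRec

theorem smul_add_aux (r : k) (a b : FreeVL k X) : r • (a + b) = r • a + r • b := by
  obtain ⟨a⟩ := a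
  obtain ⟨b⟩ := b
  exact Quotient.sound (Rel.smul_add r a b)

theorem add_smul_aux (r s : k) (a : FreeVL k X) : (r + s) • a = r • a + s • a := by
  obtain ⟨a⟩ := a
  exact Quotient.sound (Rel.add_smul r s a)

instance : Module k (FreeVL k X) where
  one_smul := by
    rintro ⟨a⟩
    exact Quotient.sound (Rel.one_smul a)
  mul_smul r s := by
    rintro ⟨a⟩
    exact Quotient.sound (Rel.mul_smul r s a)
  smul_add := smul_add_aux
  add_smul := add_smul_aux
  smul_zero r := by
    have h := smul_add_aux r (0 : FreeVL k X) 0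
    rw [add_zero] at h
    exact left_eq_add.1 h
  zero_smul a := by
    have h := add_smul_aux 0 0 a
    rw [add_zero] at h
    exact left_eq_add.1 h

instance : Lattice (FreeVL k X) :=
  letI : Max (FreeVL k X) :=
    ⟨Quotient.map₂ VLTerm.sup fun _ _ h _ _ h' => Rel.sup_congr h h'⟩
  letI : Min (FreeVL k X) :=
    ⟨Quotient.map₂ VLTerm.inf fun _ _ h _ _ h' => Rel.inf_congr h h'⟩
  Lattice.mk'
    (by rintro ⟨a⟩ ⟨b⟩; exact Quotient.sound (Rel.sup_comm a b))
    (by rintro ⟨a⟩ ⟨b⟩ ⟨c⟩; exact Quotient.sound (Rel.sup_assoc a b c))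
    (by rintro ⟨a⟩ ⟨b⟩; exact Quotient.sound (Rel.inf_comm a b))
    (by rintro ⟨a⟩ ⟨b⟩ ⟨c⟩; exact Quotient.sound (Rel.inf_assoc a b c))
    (by rintro ⟨a⟩ ⟨b⟩; exact Quotient.sound (Rel.sup_inf_self a b))
    (by rintro ⟨a⟩ ⟨b⟩; exact Quotient.sound (Rel.inf_sup_self a b))

theorem add_sup_aux (a b c : FreeVL k X) : a + (b ⊔ c) = (a + b) ⊔ (a + c) := by
  obtain ⟨a⟩ := a
  obtain ⟨b⟩ := b
  obtain ⟨c⟩ := c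
  exact Quotient.sound (Rel.add_sup a b c)

theorem smul_sup_aux {r : k} (hr : 0 ≤ r) (a b : FreeVL k X) :
    r • (a ⊔ b) = r • a ⊔ r • b := by
  obtain ⟨a⟩ := a
  obtain ⟨b⟩ := b
  exact Quotient.sound (Rel.smul_sup r hr a b)

instance : IsOrderedAddMonoid (FreeVL k X) where
  add_le_add_left a b h c := by
    rw [add_comm a c, add_comm b c, ← sup_eq_right, ← add_sup_aux, sup_eq_right.2 h]

instance : PosSMulMono k (FreeVL k X) where
  smul_le_smul_of_nonneg_left r hr a b h := by
    rw [← sup_eq_right, ← smul_sup_aux hr, sup_eq_right.2 h]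

end Instances

variable {k X : Type*} [DivisionRing k] [LinearOrder k] [IsStrictOrderedRing k]
variable {V : Type*} [AddCommGroup V] [Lattice V] [IsOrderedAddMonoid V] [Module k V]
  [PosSMulMono k V]

/-- The homomorphism of vector lattices from the free one that extends a given map on the
generators. -/
def lift (v : X → V) : VectorLatticeHom k (FreeVL k X) V where
  toFun := Quotient.lift (VLTerm.eval v) fun _ _ h => VLTerm.Rel.eval_eq v h
  map_add' := by rintro ⟨a⟩ ⟨b⟩; rfl
  map_smul' := by rintro r ⟨a⟩; rfl
  map_sup' := by rintro ⟨a⟩ ⟨b⟩; rfl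
  map_inf' := by rintro ⟨a⟩ ⟨b⟩; rfl

theorem lift_of (v : X → V) (x : X) : (lift (k := k) v).toLinearMap (of x) = v x := rfl

theorem lift_unique (v : X → V) (h : VectorLatticeHom k (FreeVL k X) V)
    (hv : ∀ x, h.toLinearMap (of x) = v x) (a : FreeVL k X) :
    h.toLinearMap a = (lift (k := k) v).toLinearMap a := by
  obtain ⟨t⟩ := a
  induction t with
  | of x => exact hv x
  | zero => exact h.toLinearMap.map_zero
  | add a b iha ihb => exact (h.toLinearMap.map_add _ _).trans (congrArg₂ (· + ·) iha ihb)
  | neg a iha => exact (h.toLinearMap.map_neg _).trans (congrArg (- ·) iha)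
  | smul r a iha => exact (h.toLinearMap.map_smul r _).trans (congrArg (r • ·) iha)
  | sup a b iha ihb => exact (h.map_sup' _ _).trans (congrArg₂ (· ⊔ ·) iha ihb)
  | inf a b iha ihb => exact (h.map_inf' _ _).trans (congrArg₂ (· ⊓ ·) iha ihb)

variable (k) in
/-- The canonical homomorphism `F_ℓ(I, k) → F_ℓ(J, k)` for `I ⊆ J`, which sends each generator
`i ∈ I` to the generator `i`. -/
def inclusion {J : Type*} (I : Set J) : VectorLatticeHom k (FreeVL k I) (FreeVL k J) :=
  lift fun i => of (i : J)

end FreeVL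

/-- `η_{I,J} : Id_c F_ℓ(I, k) → Id_c F_ℓ(J, k)`, the lattice homomorphism induced by `I ⊆ J`. -/
noncomputable def eta (k : Type*) [DivisionRing k] [LinearOrder k] [IsStrictOrderedRing k]
    {J : Type*} (I : Set J) : LatticeHom (Idc k (FreeVL k I)) (Idc k (FreeVL k J)) :=
  idcMap (FreeVL.inclusion k I)

/-!
A `0`-lattice homomorphism on `Op⁻` amounts to a map on linear forms which satisfies the relations
between the half-spaces `{x | 0 < a x}`. Indeed, evaluated at a prime of the target, such a map
prescribes a sign for every form, and Fourier–Motzkin elimination produces a point realizing the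
prescribed signs on any given finite set of forms.

One may thus extend a map on the forms supported in `I` one form `b` at a time. By elimination, only
finitely many of the old forms matter. From their values one builds an element `c` of `L` which
holds at a prime only if `0 < b` is possible there, and whenever it is forced; let `d` play the same
role for `-b`. Complete normality of `L` trims `c` and `d` to disjoint elements whose prescribed
signs can still be realized at every prime, and these serve as the values at `b` and `-b`.

A basis vector outside `I` and the forms treated so far can be given any value, which makes the
extension surjective: as `k`, `J` and `L` are countable, all these requirements are met in
countably many steps.

For `Id_c F_ℓ`, the ideals `⟨a⁺⟩` of the linear elements `a` generate the lattice and satisfy the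
same relations, so that an extension may be constructed on `Op⁻` and pulled back along
`⟨a⁺⟩ ↦ {x | 0 < a x}`.
-/

theorem denselyOrdered_of_divisionRing (k : Type*) [DivisionRing k] [LinearOrder k]
    [IsStrictOrderedRing k] : DenselyOrdered k where
  dense a b hab := by
    have half_pos : (0 : k) < 2⁻¹ := inv_pos.2 two_pos
    have half_lt_one : (2 : k)⁻¹ < 1 := inv_lt_one_of_one_lt₀ one_lt_two
    have hlen : 0 < b - a := sub_pos.2 hab
    refine ⟨a + (b - a) * 2⁻¹, lt_add_of_pos_right a (mul_pos hlen half_pos), ?_⟩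
    rw [← lt_sub_iff_add_lt']
    exact mul_lt_of_lt_one_right hlen half_lt_one

theorem prop_map_sup {L : Type*} [Lattice L] (P : LatticeHom L Prop) (a b : L) :
    P (a ⊔ b) ↔ P a ∨ P b :=
  Iff.of_eq (map_sup P a b)

theorem prop_map_inf {L : Type*} [Lattice L] (P : LatticeHom L Prop) (a b : L) :
    P (a ⊓ b) ↔ P a ∧ P b :=
  Iff.of_eq (map_inf P a b)

theorem prop_map_finset_sup {L ι : Type*} [Lattice L] [OrderBot L] (P : LatticeHom L Prop)
    (hP : P ⊥ = ⊥) (s : Finset ι) (f : ι → L) : P (s.sup f) ↔ ∃ i ∈ s, P (f i) := by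
  induction s using Finset.cons_induction with
  | empty => simp [hP]
  | cons i s hi ih => simp [ih]

theorem prop_map_finset_inf' {L ι : Type*} [Lattice L] (P : LatticeHom L Prop) {s : Finset ι}
    (hs : s.Nonempty) (f : ι → L) : P (s.inf' hs f) ↔ ∀ i ∈ s, P (f i) := by
  induction hs using Finset.Nonempty.cons_induction with
  | singleton i => simp
  | cons i s hi hs ih => simp [Finset.inf'_cons hs, ih]

theorem exists_forall_prop_map_iff {L : Type*} [Lattice L] [OrderBot L] (S : Finset L)
    (U : Finset L → Prop) :
    ∃ a : L, ∀ P : LatticeHom L Prop, P ⊥ = ⊥ →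
      (P a ↔ ∃ σ ⊆ S, σ.Nonempty ∧ U σ ∧ ∀ c ∈ σ, P c) := by
  classical
  let meet (σ : Finset L) : L := if hσ : σ.Nonempty then σ.inf' hσ id else ⊥
  refine ⟨{σ ∈ S.powerset | σ.Nonempty ∧ U σ}.sup meet, fun P hP => ?_⟩
  have map_meet {σ : Finset L} (hσ : σ.Nonempty) : P (meet σ) ↔ ∀ c ∈ σ, P c := by
    simp only [meet, dif_pos hσ, prop_map_finset_inf', id]
  simp only [prop_map_finset_sup P hP, Finset.mem_filter, Finset.mem_powerset, and_assoc]
  exact exists_congr fun σ => and_congr_right fun _ => and_congr_right fun hσ =>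
    and_congr_right fun _ => map_meet hσ

section PrimeSeparation

variable {L : Type*} [DistribLattice L] [OrderBot L]

theorem le_of_forall_prop_map {a b : L}
    (h : ∀ P : LatticeHom L Prop, P ⊥ = ⊥ → P a → P b) : a ≤ b := by
  by_contra hab
  have hdisj : Disjoint (Order.PFilter.principal a : Set L) (Order.Ideal.principal b : Set L) :=
    Set.disjoint_left.2 fun c hac hcb => hab (le_trans hac hcb)
  obtain ⟨𝔭, hprime, hb𝔭, ha𝔭⟩ := DistribLattice.prime_ideal_of_disjoint_filter_ideal hdisj
  let P : LatticeHom L Prop :=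
    { toFun c := c ∉ 𝔭
      map_sup' c d := propext (by
        change ¬(c ⊔ d ∈ 𝔭) ↔ c ∉ 𝔭 ∨ d ∉ 𝔭
        rw [Order.Ideal.sup_mem_iff, not_and_or])
      map_inf' c d := propext
        ⟨fun hcd => ⟨mt (𝔭.lower inf_le_left) hcd, mt (𝔭.lower inf_le_right) hcd⟩,
          fun ⟨hc, hd⟩ hcd => (hprime.mem_or_mem hcd).elim hc hd⟩ }
  have hP : P ⊥ = ⊥ := eq_false fun hbot => hbot 𝔭.bot_mem
  have ha : P a := fun ha => Set.disjoint_left.1 ha𝔭 (le_refl a) ha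
  exact h P hP ha (hb𝔭 (le_refl b))

theorem eq_of_forall_prop_map_iff {a b : L}
    (h : ∀ P : LatticeHom L Prop, P ⊥ = ⊥ → (P a ↔ P b)) : a = b :=
  le_antisymm (le_of_forall_prop_map fun P hP => (h P hP).1)
    (le_of_forall_prop_map fun P hP => (h P hP).2)

end PrimeSeparation

section LinFunctional

variable {k J : Type*} [DivisionRing k]

theorem linFunctional_add (a b x : J →₀ k) :
    linFunctional (a + b) x = linFunctional a x + linFunctional b x :=
  map_add (Finsupp.linearCombination k x) a b

theorem linFunctional_sub (a b x : J →₀ k) :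
    linFunctional (a - b) x = linFunctional a x - linFunctional b x :=
  map_sub (Finsupp.linearCombination k x) a b

theorem linFunctional_neg (a x : J →₀ k) : linFunctional (-a) x = -linFunctional a x :=
  map_neg (Finsupp.linearCombination k x) a

theorem linFunctional_smul (c : k) (a x : J →₀ k) :
    linFunctional (c • a) x = c * linFunctional a x :=
  map_smul (Finsupp.linearCombination k x) c a

theorem linFunctional_single_one (i : J) (x : J →₀ k) :
    linFunctional (Finsupp.single i 1) x = x i := by
  simp [linFunctional]

theorem linFunctional_zero_right (a : J →₀ k) : linFunctional a 0 = 0 := by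
  simp [linFunctional]

theorem linFunctional_add_right (a x y : J →₀ k) :
    linFunctional a (x + y) = linFunctional a x + linFunctional a y := by
  simp only [linFunctional, Finsupp.add_apply, mul_add, Finsupp.sum_add]

theorem linFunctional_op_smul_right (a x : J →₀ k) (c : k) :
    linFunctional a (MulOpposite.op c • x) = linFunctional a x * c := by
  simp only [linFunctional, Finsupp.smul_apply, op_smul_eq_mul, Finsupp.sum_mul,
    mul_assoc]

theorem linFunctional_single_right (a : J →₀ k) (i : J) (c : k) :
    linFunctional a (Finsupp.single i c) = a i * c := by
  classical
  simp +contextual [linFunctional, Finsupp.single_apply, Finsupp.sum_ite_eq]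

theorem linFunctional_congr {I : Set J} {a x y : J →₀ k} (ha : a ∈ Finsupp.supported k k I)
    (h : ∀ i ∈ I, x i = y i) : linFunctional a x = linFunctional a y :=
  Finset.sum_congr rfl fun i hi =>
    congrArg (a i * ·) (h i ((Finsupp.mem_supported k a).1 ha hi))

end LinFunctional

/-- A map from a vector space to a lattice which satisfies the relations between the open
half-spaces `{x | 0 < a x}`: it depends only on the ray of `a`, the half-space of `a + b` is
contained in the union of those of `a` and `b`, and those of `a` and `-a` are disjoint. -/
structure IsHalfSpaceMap (k : Type*) {E M : Type*} [DivisionRing k] [LinearOrder k]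
    [AddCommGroup E] [Module k E] [Lattice M] [OrderBot M] (t : E → M) : Prop where
  map_smul : ∀ ⦃c : k⦄, 0 < c → ∀ a, t (c • a) = t a
  map_add_le : ∀ a b, t (a + b) ≤ t a ⊔ t b
  map_inf_map_neg : ∀ a, t a ⊓ t (-a) = ⊥

/-- The values of a map at `a` and at `-a`. For the map given by the half-spaces containing a
point `x`, they encode the sign of `a x`. -/
def signPair {E M : Type*} [Neg E] (t : E → M) (a : E) : M × M := (t a, t (-a))

theorem signPair_eq_iff {E M : Type*} [Neg E] {s t : E → M} {a : E} :
    signPair s a = signPair t a ↔ s a = t a ∧ s (-a) = t (-a) :=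
  Prod.mk_inj

namespace IsHalfSpaceMap

variable {k E M : Type*} [DivisionRing k] [LinearOrder k] [AddCommGroup E] [Module k E]

section Lattice

variable [Lattice M] [OrderBot M] {t : E → M}

theorem comp {N : Type*} [Lattice N] [OrderBot N] (ht : IsHalfSpaceMap k t) (f : LatticeHom M N)
    (hf : f ⊥ = ⊥) : IsHalfSpaceMap k (f ∘ t) where
  map_smul c hc a := congrArg f (ht.map_smul hc a)
  map_add_le a b := by
    simpa only [Function.comp_apply, map_sup] using OrderHomClass.mono f (ht.map_add_le a b)
  map_inf_map_neg a := by
    rw [Function.comp_apply, Function.comp_apply, ← map_inf, ht.map_inf_map_neg, hf]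

theorem comp_linearMap {E' : Type*} [AddCommGroup E'] [Module k E'] (ht : IsHalfSpaceMap k t)
    (f : E' →ₗ[k] E) : IsHalfSpaceMap k (t ∘ f) where
  map_smul c hc a := (congrArg t (f.map_smul c a)).trans (ht.map_smul hc (f a))
  map_add_le a b := (congrArg t (f.map_add a b)).trans_le (ht.map_add_le (f a) (f b))
  map_inf_map_neg a := (congrArg (t (f a) ⊓ t ·) (f.map_neg a)).trans (ht.map_inf_map_neg (f a))

theorem map_zero (ht : IsHalfSpaceMap k t) : t 0 = ⊥ := by
  simpa only [neg_zero, inf_idem] using ht.map_inf_map_neg 0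

theorem signPair_zero (ht : IsHalfSpaceMap k t) : signPair t 0 = ⊥ :=
  Prod.ext ht.map_zero ((congrArg t neg_zero).trans ht.map_zero)

theorem signPair_smul_eq_iff [IsStrictOrderedRing k] {s : E → M} (hs : IsHalfSpaceMap k s)
    (ht : IsHalfSpaceMap k t) {c : k} (hc : c ≠ 0) (a : E) :
    signPair s (c • a) = signPair t (c • a) ↔ signPair s a = signPair t a := by
  rcases hc.lt_or_gt with hneg | hpos
  · have hscale : c • a = -(-c • a) := by rw [neg_smul, neg_neg]
    have hcpos : 0 < -c := neg_pos.2 hneg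
    simp only [signPair_eq_iff, hscale, neg_neg, ← smul_neg (-c), hs.map_smul hcpos,
      ht.map_smul hcpos, and_comm]
  · simp only [signPair_eq_iff, ← smul_neg, hs.map_smul hpos, ht.map_smul hpos]

end Lattice

section PropValued

variable {p q : E → Prop} {a b : E}

theorem not_neg (hp : IsHalfSpaceMap k p) (ha : p a) : ¬p (-a) := fun hna =>
  Iff.of_eq (hp.map_inf_map_neg a) |>.1 ⟨ha, hna⟩

theorem pos_or_pos_of_add (hp : IsHalfSpaceMap k p) (h : p (a + b)) : p a ∨ p b :=
  hp.map_add_le a b h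

theorem add_pos (hp : IsHalfSpaceMap k p) (ha : p a) (hb : ¬p (-b)) : p (a + b) := by
  rw [← add_neg_cancel_right a b] at ha
  exact (hp.pos_or_pos_of_add ha).resolve_right hb

theorem pos_sub_iff (hp : IsHalfSpaceMap k p) (hpos : ¬p b) (hneg : ¬p (-b)) :
    p (a - b) ↔ p a := by
  refine ⟨fun h => ?_, fun h => ?_⟩
  · simpa only [sub_add_cancel] using hp.add_pos h hneg
  · simpa only [sub_eq_add_neg] using hp.add_pos h (by rwa [neg_neg])

theorem signPair_sub (hp : IsHalfSpaceMap k p) (hb : signPair p b = ⊥) :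
    signPair p (a - b) = signPair p a := by
  have hpos : ¬p b := fun h => (congrArg Prod.fst hb).mp h
  have hneg : ¬p (-b) := fun h => (congrArg Prod.snd hb).mp h
  refine Prod.ext (propext (hp.pos_sub_iff hpos hneg)) (propext ?_)
  change p (-(a - b)) ↔ p (-a)
  rw [neg_sub, ← neg_sub_neg]
  exact hp.pos_sub_iff hneg (by rwa [neg_neg])

theorem signPair_eq_of_pos (hp : IsHalfSpaceMap k p) (hq : IsHalfSpaceMap k q) (hpa : p a)
    (hqa : q a) : signPair p a = signPair q a :=
  signPair_eq_iff.2 ⟨(eq_true hpa).trans (eq_true hqa).symm,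
    (eq_false (hp.not_neg hpa)).trans (eq_false (hq.not_neg hqa)).symm⟩

theorem signPair_eq_of_neg (hp : IsHalfSpaceMap k p) (hq : IsHalfSpaceMap k q) (hpa : p (-a))
    (hqa : q (-a)) : signPair p a = signPair q a := by
  have hp' : ¬p a := fun h => hp.not_neg h hpa
  have hq' : ¬q a := fun h => hq.not_neg h hqa
  exact signPair_eq_iff.2 ⟨(eq_false hp').trans (eq_false hq').symm,
    (eq_true hpa).trans (eq_true hqa).symm⟩

end PropValued

end IsHalfSpaceMap

section PosAt

variable {k J : Type*} [DivisionRing k] [LinearOrder k]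

/-- The point `x` lies in the open half-space `{x | 0 < a x}`. -/
def posAt (x a : J →₀ k) : Prop := 0 < linFunctional a x

theorem posAt_congr {I : Set J} {a x y : J →₀ k} (ha : a ∈ Finsupp.supported k k I)
    (h : ∀ i ∈ I, x i = y i) : posAt x a ↔ posAt y a := by
  rw [posAt, posAt, linFunctional_congr ha h]

theorem signPair_posAt_congr {I : Set J} {a x y : J →₀ k} (ha : a ∈ Finsupp.supported k k I)
    (h : ∀ i ∈ I, x i = y i) : signPair (posAt x) a = signPair (posAt y) a :=
  signPair_eq_iff.2 ⟨propext (posAt_congr ha h), propext (posAt_congr (neg_mem ha) h)⟩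

theorem signPair_posAt_add_single {i : J} {a : J →₀ k} (ha : a i = 0) (x : J →₀ k) (s : k) :
    signPair (posAt (x + Finsupp.single i s)) a = signPair (posAt x) a := by
  refine signPair_eq_iff.2 ⟨?_, ?_⟩ <;>
    simp only [posAt, linFunctional_add_right, linFunctional_single_right, Finsupp.neg_apply, ha,
      neg_zero, zero_mul, add_zero]

variable [IsStrictOrderedRing k]

theorem posAt_neg {x a : J →₀ k} : posAt x (-a) ↔ linFunctional a x < 0 := by
  rw [posAt, linFunctional_neg, neg_pos]

theorem signPair_posAt_eq_bot {x a : J →₀ k} (h : linFunctional a x = 0) :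
    signPair (posAt x) a = ⊥ :=
  Prod.ext (eq_false h.not_gt) (eq_false fun hneg => h.not_lt (posAt_neg.1 hneg))

theorem isHalfSpaceMap_posAt (x : J →₀ k) : IsHalfSpaceMap k (posAt x) where
  map_smul c hc a := by
    rw [posAt, linFunctional_smul, mul_pos_iff_of_pos_left hc, posAt]
  map_add_le a b h := by
    by_contra hab
    obtain ⟨ha, hb⟩ := not_or.1 hab
    rw [posAt, linFunctional_add] at h
    exact h.not_ge (add_nonpos (not_lt.1 ha) (not_lt.1 hb))
  map_inf_map_neg a := eq_false fun ⟨ha, hna⟩ => lt_asymm ha (posAt_neg.1 hna)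

end PosAt

section Elimination

variable {k J : Type*} [DivisionRing k]

open Classical in
/-- The Fourier–Motzkin elimination of the variable `i` from a finite set of linear forms: the forms
not containing `i`, and the differences of the others after normalizing the coefficient of `i`
to `1`. -/
noncomputable def eliminate (i : J) (G : Finset (J →₀ k)) : Finset (J →₀ k) :=
  {g ∈ G | g i = 0} ∪
    Finset.image₂ (fun g h => (g i)⁻¹ • g - (h i)⁻¹ • h) {g ∈ G | g i ≠ 0} {g ∈ G | g i ≠ 0}

theorem mem_eliminate {i : J} {G : Finset (J →₀ k)} {w : J →₀ k} :
    w ∈ eliminate i G ↔ (w ∈ G ∧ w i = 0) ∨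
      ∃ g, (g ∈ G ∧ g i ≠ 0) ∧ ∃ h, (h ∈ G ∧ h i ≠ 0) ∧ (g i)⁻¹ • g - (h i)⁻¹ • h = w := by
  simp only [eliminate, Finset.mem_union, Finset.mem_filter, Finset.mem_image₂]

theorem apply_eq_zero_of_mem_eliminate {i : J} {G : Finset (J →₀ k)} {w : J →₀ k}
    (hw : w ∈ eliminate i G) : w i = 0 := by
  rcases mem_eliminate.1 hw with ⟨-, hw⟩ | ⟨g, ⟨-, hg⟩, h, ⟨-, hh⟩, rfl⟩
  · exact hw
  · simp [hg, hh]

theorem eliminate_subset_span (i : J) (G : Finset (J →₀ k)) :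
    (eliminate i G : Set (J →₀ k)) ⊆ Submodule.span k (G : Set (J →₀ k)) := by
  intro w hw
  rcases mem_eliminate.1 hw with ⟨hw, -⟩ | ⟨g, ⟨hg, -⟩, h, ⟨hh, -⟩, rfl⟩
  · exact Submodule.subset_span hw
  · exact sub_mem (Submodule.smul_mem _ _ (Submodule.subset_span hg))
      (Submodule.smul_mem _ _ (Submodule.subset_span hh))

variable [LinearOrder k] [IsStrictOrderedRing k]

theorem exists_shift_signPair_eq_of_signPair_eq_bot {i : J} {N : Finset (J →₀ k)}
    (hN : ∀ b ∈ N, b i = 1) {p : (J →₀ k) → Prop} (hp : IsHalfSpaceMap k p) {y c : J →₀ k}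
    (hc : c ∈ N) (hpc : signPair p c = ⊥)
    (h : ∀ b ∈ N, signPair p (b - c) = signPair (posAt y) (b - c)) :
    ∃ s : k, ∀ b ∈ N, signPair p b = signPair (posAt (y + Finsupp.single i s)) b := by
  let z := y + Finsupp.single i (-linFunctional c y)
  have hzc : linFunctional c z = 0 := by
    rw [linFunctional_add_right, linFunctional_single_right, hN c hc, one_mul, add_neg_cancel]
  refine ⟨-linFunctional c y, fun b hb => ?_⟩
  have hbc : (b - c) i = 0 := by rw [Finsupp.sub_apply, hN b hb, hN c hc, sub_self]
  calc signPair p b = signPair p (b - c) := (hp.signPair_sub hpc).symm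
    _ = signPair (posAt y) (b - c) := h b hb
    _ = signPair (posAt z) (b - c) := (signPair_posAt_add_single hbc y _).symm
    _ = signPair (posAt z) b := (isHalfSpaceMap_posAt z).signPair_sub (signPair_posAt_eq_bot hzc)

/-- The signs impose finitely many strict lower and upper bounds on the shift. -/
theorem exists_shift_signPair_eq_of_pos_or_neg {i : J} {N : Finset (J →₀ k)}
    (hN : ∀ b ∈ N, b i = 1) {p : (J →₀ k) → Prop} (hp : IsHalfSpaceMap k p)
    (pos_or_neg : ∀ b ∈ N, p b ∨ p (-b)) {y : J →₀ k}
    (h : ∀ b ∈ N, ∀ c ∈ N, p (b - c) → posAt y (b - c)) :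
    ∃ s : k, ∀ b ∈ N, signPair p b = signPair (posAt (y + Finsupp.single i s)) b := by
  classical
  have value {b : J →₀ k} (hb : b ∈ N) (s : k) :
      linFunctional b (y + Finsupp.single i s) = linFunctional b y + s := by
    rw [linFunctional_add_right, linFunctional_single_right, hN b hb, one_mul]
  have := denselyOrdered_of_divisionRing k
  obtain ⟨s, hlo, hhi⟩ := Order.exists_between_finsets
    ({b ∈ N | p b}.image fun b => -linFunctional b y)
    ({b ∈ N | p (-b)}.image fun b => -linFunctional b y) (by
      simp only [Finset.forall_mem_image, Finset.mem_filter]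
      rintro b ⟨hb, hpb⟩ c ⟨hc, hpc⟩
      have hpbc : p (b - c) := by
        rw [sub_eq_add_neg]
        exact hp.add_pos hpb (hp.not_neg hpc)
      have hybc : posAt y (b - c) := h b hb c hc hpbc
      rw [posAt, linFunctional_sub, sub_pos] at hybc
      exact neg_lt_neg hybc)
  simp only [Finset.forall_mem_image, Finset.mem_filter] at hlo hhi
  refine ⟨s, fun b hb => ?_⟩
  rcases pos_or_neg b hb with hpb | hpb
  · have hpos : posAt (y + Finsupp.single i s) b := by
      rw [posAt, value hb]
      exact neg_lt_iff_pos_add'.1 (hlo ⟨hb, hpb⟩)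
    exact hp.signPair_eq_of_pos (isHalfSpaceMap_posAt _) hpb hpos
  · have hneg : posAt (y + Finsupp.single i s) (-b) := by
      rw [posAt_neg, value hb]
      exact lt_neg_iff_add_neg'.1 (hhi ⟨hb, hpb⟩)
    exact hp.signPair_eq_of_neg (isHalfSpaceMap_posAt _) hpb hneg

theorem exists_shift_signPair_eq {i : J} {N : Finset (J →₀ k)} (hN : ∀ b ∈ N, b i = 1)
    {p : (J →₀ k) → Prop} (hp : IsHalfSpaceMap k p) {y : J →₀ k}
    (h : ∀ b ∈ N, ∀ c ∈ N, signPair p (b - c) = signPair (posAt y) (b - c)) :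
    ∃ s : k, ∀ b ∈ N, signPair p b = signPair (posAt (y + Finsupp.single i s)) b := by
  by_cases hzero : ∃ c ∈ N, signPair p c = ⊥
  · obtain ⟨c, hc, hpc⟩ := hzero
    exact exists_shift_signPair_eq_of_signPair_eq_bot hN hp hc hpc fun b hb => h b hb c hc
  · refine exists_shift_signPair_eq_of_pos_or_neg hN hp (fun b hb => ?_)
      fun b hb c hc => (congrArg Prod.fst (h b hb c hc)).mp
    by_contra hnot
    obtain ⟨hpos, hneg⟩ := not_or.1 hnot
    exact hzero ⟨b, hb, Prod.ext (eq_false hpos) (eq_false hneg)⟩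

theorem exists_shift_of_eliminate {i : J} {G : Finset (J →₀ k)} {p : (J →₀ k) → Prop}
    (hp : IsHalfSpaceMap k p) {y : J →₀ k}
    (h : ∀ w ∈ eliminate i G, signPair p w = signPair (posAt y) w) :
    ∃ s : k, ∀ a ∈ G, signPair p a = signPair (posAt (y + Finsupp.single i s)) a := by
  classical
  let N := {g ∈ G | g i ≠ 0}.image fun g => (g i)⁻¹ • g
  have hN : ∀ b ∈ N, b i = 1 := by
    simp only [N, Finset.forall_mem_image, Finset.mem_filter]
    rintro g ⟨-, hg⟩
    rw [Finsupp.smul_apply, smul_eq_mul, inv_mul_cancel₀ hg]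
  obtain ⟨s, hs⟩ := exists_shift_signPair_eq hN hp (y := y) <| by
    simp only [N, Finset.forall_mem_image, Finset.mem_filter]
    intro g hg c hc
    exact h _ (mem_eliminate.2 (.inr ⟨g, hg, c, hc, rfl⟩))
  refine ⟨s, fun a ha => ?_⟩
  by_cases hai : a i = 0
  · rw [signPair_posAt_add_single hai]
    exact h a (mem_eliminate.2 (.inl ⟨ha, hai⟩))
  · rw [← hp.signPair_smul_eq_iff (isHalfSpaceMap_posAt _) (inv_ne_zero hai)]
    exact hs _ (Finset.mem_image_of_mem _ (Finset.mem_filter.2 ⟨ha, hai⟩))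

theorem exists_finset_vanishing_lift (T : Finset J) (G : Finset (J →₀ k)) :
    ∃ W : Finset (J →₀ k), (W : Set (J →₀ k)) ⊆ Submodule.span k (G : Set (J →₀ k)) ∧
      (∀ w ∈ W, ∀ i ∈ T, w i = 0) ∧
      ∀ p : (J →₀ k) → Prop, IsHalfSpaceMap k p → ∀ y : J →₀ k,
        (∀ w ∈ W, signPair p w = signPair (posAt y) w) →
        ∃ z : J →₀ k, (∀ j ∉ T, z j = y j) ∧ ∀ a ∈ G, signPair p a = signPair (posAt z) a := by
  classical
  induction T using Finset.induction_on with
  | empty =>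
    exact ⟨G, Submodule.subset_span, fun _ _ _ h => absurd h (Finset.notMem_empty _),
      fun p _ y h => ⟨y, fun _ _ => rfl, h⟩⟩
  | insert i T _ ih =>
    obtain ⟨W, hWG, hWT, lift⟩ := ih
    have hspan := eliminate_subset_span i W
    refine ⟨eliminate i W, hspan.trans (Submodule.span_le.2 hWG), fun w hw j hj => ?_,
      fun p hp y hy => ?_⟩
    · rcases Finset.mem_insert.1 hj with rfl | hj
      · exact apply_eq_zero_of_mem_eliminate hw
      · have hW : Submodule.span k (W : Set (J →₀ k)) ≤ (Finsupp.lapply j).ker :=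
          Submodule.span_le.2 fun v hv => hWT v hv j hj
        exact hW (hspan hw)
    · obtain ⟨s, hs⟩ := exists_shift_of_eliminate hp hy
      obtain ⟨z, hz, hzG⟩ := lift p hp _ hs
      refine ⟨z, fun j hj => ?_, hzG⟩
      rw [Finset.mem_insert, not_or] at hj
      rw [hz j hj.2, Finsupp.add_apply, Finsupp.single_eq_of_ne hj.1, add_zero]

theorem exists_finset_supported_lift (I : Set J) (G : Finset (J →₀ k)) :
    ∃ W : Finset (J →₀ k), (W : Set (J →₀ k)) ⊆ Finsupp.supported k k I ∧
      ∀ p : (J →₀ k) → Prop, IsHalfSpaceMap k p → ∀ y : J →₀ k,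
        (∀ w ∈ W, signPair p w = signPair (posAt y) w) →
        ∃ z : J →₀ k, (∀ i ∈ I, z i = y i) ∧ ∀ a ∈ G, signPair p a = signPair (posAt z) a := by
  classical
  let S : Finset J := G.biUnion Finsupp.support
  obtain ⟨W, hWG, hWT, lift⟩ := exists_finset_vanishing_lift {j ∈ S | j ∉ I} G
  have hGS : Submodule.span k (G : Set (J →₀ k)) ≤ Finsupp.supported k k (S : Set J) :=
    Submodule.span_le.2 fun g hg =>
      (Finsupp.mem_supported k g).2 (Finset.coe_subset.2 (Finset.subset_biUnion_of_mem _ hg))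
  refine ⟨W, fun w hw => (Finsupp.mem_supported' k w).2 fun j hj => ?_, fun p hp y hy => ?_⟩
  · by_cases hjS : j ∈ S
    · exact hWT w hw j (Finset.mem_filter.2 ⟨hjS, hj⟩)
    · exact (Finsupp.mem_supported' k w).1 (hGS (hWG hw)) j hjS
  · obtain ⟨z, hz, hzG⟩ := lift p hp y hy
    exact ⟨z, fun i hi => hz i fun hiT => (Finset.mem_filter.1 hiT).2 hi, hzG⟩

theorem IsHalfSpaceMap.exists_point {p : (J →₀ k) → Prop} (hp : IsHalfSpaceMap k p)
    (G : Finset (J →₀ k)) : ∃ x : J →₀ k, ∀ a ∈ G, signPair p a = signPair (posAt x) a := by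
  obtain ⟨W, hW, lift⟩ := exists_finset_supported_lift (∅ : Set J) G
  rw [Finsupp.supported_empty] at hW
  obtain ⟨x, -, hx⟩ := lift p hp 0 fun w hw => by
    rw [(hW hw : w = 0), hp.signPair_zero, (isHalfSpaceMap_posAt 0).signPair_zero]
  exact ⟨x, hx⟩

end Elimination

section HalfSpace

variable {k J : Type*} [DivisionRing k] [LinearOrder k]

/-- The open half-space `{x | 0 < a x}` as an element of `Op⁻`. -/
def halfSpace (a : J →₀ k) : OpSpace k J :=
  ⟨{x | posAt x a}, subset_latticeClosure ⟨linFunctional a, ⟨a, rfl⟩, .inl rfl⟩⟩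

theorem mem_halfSpace {a x : J →₀ k} : x ∈ (halfSpace a : Set (J →₀ k)) ↔ posAt x a := Iff.rfl

/-- Membership in `X` and truth of `l` are governed by the same lattice polynomial, in finitely many
half-spaces and in their `t`-values respectively. -/
def HasValue {L : Type*} [Lattice L] [OrderBot L] (t : (J →₀ k) → L) (X : OpSpace k J) (l : L) :
    Prop :=
  ∃ A : Finset (J →₀ k), ∀ P : LatticeHom L Prop, P ⊥ = ⊥ → ∀ x : J →₀ k,
    (∀ a ∈ A, P (t a) ↔ posAt x a) → (x ∈ (X : Set (J →₀ k)) ↔ P l)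

namespace HasValue

variable {L : Type*} [Lattice L] [OrderBot L] {t : (J →₀ k) → L} {X Y : OpSpace k J}
  {l m : L}

theorem halfSpace (a : J →₀ k) : HasValue t (halfSpace a) (t a) :=
  ⟨{a}, fun _ _ _ h => (h a (Finset.mem_singleton_self a)).symm⟩

theorem sup (hX : HasValue t X l) (hY : HasValue t Y m) : HasValue t (X ⊔ Y) (l ⊔ m) := by
  classical
  obtain ⟨A, hA⟩ := hX
  obtain ⟨B, hB⟩ := hY
  refine ⟨A ∪ B, fun P hP x hx => ?_⟩
  rw [Finset.forall_mem_union] at hx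
  rw [prop_map_sup, ← hA P hP x hx.1, ← hB P hP x hx.2]
  rfl

theorem inf (hX : HasValue t X l) (hY : HasValue t Y m) : HasValue t (X ⊓ Y) (l ⊓ m) := by
  classical
  obtain ⟨A, hA⟩ := hX
  obtain ⟨B, hB⟩ := hY
  refine ⟨A ∪ B, fun P hP x hx => ?_⟩
  rw [Finset.forall_mem_union] at hx
  rw [prop_map_inf, ← hA P hP x hx.1, ← hB P hP x hx.2]
  rfl

end HasValue

variable [IsStrictOrderedRing k]

theorem isHalfSpaceMap_halfSpace : IsHalfSpaceMap k (halfSpace : (J →₀ k) → OpSpace k J) where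
  map_smul _ hc a := Subtype.ext <| Set.ext fun x =>
    Iff.of_eq ((isHalfSpaceMap_posAt x).map_smul hc a)
  map_add_le a b := fun x hx => (isHalfSpaceMap_posAt x).map_add_le a b hx
  map_inf_map_neg a := Subtype.ext <| Set.ext fun x =>
    Iff.of_eq ((isHalfSpaceMap_posAt x).map_inf_map_neg a)

theorem OpSpace.induction {motive : OpSpace k J → Prop} (basic : ∀ a, motive (halfSpace a))
    (sup : ∀ X Y, motive X → motive Y → motive (X ⊔ Y))
    (inf : ∀ X Y, motive X → motive Y → motive (X ⊓ Y)) (X : OpSpace k J) : motive X := by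
  refine latticeClosure_sup_inf_induction
    (p := fun S (hS : S ∈ OpSpace k J) => motive ⟨S, hS⟩) ?_
    (fun S hS T hT => sup ⟨S, hS⟩ ⟨T, hT⟩) (fun S hS T hT => inf ⟨S, hS⟩ ⟨T, hT⟩) X.2
  rintro S ⟨_, ⟨a, rfl⟩, rfl | rfl⟩
  · exact basic a
  · convert basic (-a) using 1
    exact Subtype.ext (Set.ext fun x => posAt_neg.symm)

theorem OpSpace.latticeHom_ext {M : Type*} [Lattice M] {f g : LatticeHom (OpSpace k J) M}
    (h : ∀ a, f (halfSpace a) = g (halfSpace a)) : f = g := by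
  refine LatticeHom.ext fun X => ?_
  induction X using OpSpace.induction with
  | basic a => exact h a
  | sup X Y hX hY => rw [map_sup, map_sup, hX, hY]
  | inf X Y hX hY => rw [map_inf, map_inf, hX, hY]

namespace HasValue

variable {L : Type*} [DistribLattice L] [OrderBot L] {t : (J →₀ k) → L} {X Y : OpSpace k J}
  {l m : L}

theorem exists_value (t : (J →₀ k) → L) (X : OpSpace k J) : ∃ l, HasValue t X l := by
  induction X using OpSpace.induction with
  | basic a => exact ⟨t a, halfSpace a⟩
  | sup X Y hX hY => exact ⟨_, hX.choose_spec.sup hY.choose_spec⟩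
  | inf X Y hX hY => exact ⟨_, hX.choose_spec.inf hY.choose_spec⟩

theorem le (ht : IsHalfSpaceMap k t) (hX : HasValue t X l) (hY : HasValue t Y m) (hXY : X ≤ Y) :
    l ≤ m := by
  classical
  obtain ⟨A, hA⟩ := hX
  obtain ⟨B, hB⟩ := hY
  refine le_of_forall_prop_map fun P hP hl => ?_
  obtain ⟨x, hx⟩ := (ht.comp P hP).exists_point (A ∪ B)
  have hx' : ∀ a ∈ A ∪ B, P (t a) ↔ posAt x a := fun a ha =>
    Iff.of_eq (signPair_eq_iff.1 (hx a ha)).1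
  rw [Finset.forall_mem_union] at hx'
  exact (hB P hP x hx'.2).1 (hXY ((hA P hP x hx'.1).2 hl))

theorem unique (ht : IsHalfSpaceMap k t) (hl : HasValue t X l) (hm : HasValue t X m) : l = m :=
  (hl.le ht hm le_rfl).antisymm (hm.le ht hl le_rfl)

end HasValue

theorem IsHalfSpaceMap.exists_latticeHom {L : Type*} [DistribLattice L] [OrderBot L]
    {t : (J →₀ k) → L} (ht : IsHalfSpaceMap k t) :
    ∃ g : LatticeHom (OpSpace k J) L, ∀ a, g (halfSpace a) = t a := by
  choose g hg using HasValue.exists_value (k := k) (J := J) t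
  refine ⟨⟨⟨g, fun X Y => ?_⟩, fun X Y => ?_⟩, fun a => ?_⟩
  · exact (hg _).unique ht ((hg X).sup (hg Y))
  · exact (hg _).unique ht ((hg X).inf (hg Y))
  · exact (hg _).unique ht (.halfSpace a)

end HalfSpace

section Cell

variable {k J L : Type*} [DivisionRing k] [LinearOrder k]

/-- The points where each `a ∈ F` has the sign prescribed at the prime `P` by the assignment `s`,
whose components are the values in `L` of the half-spaces of `a` and of `-a`. -/
def cell [Lattice L] (P : LatticeHom L Prop) (s : (J →₀ k) → L × L) (F : Finset (J →₀ k)) :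
    Set (J →₀ k) :=
  {x | ∀ a ∈ F, signPair (posAt x) a = Prod.map P P (s a)}

/-- The assignment `s` is finitely consistent on `D`: at every prime of `L` and on every finite part
of `D`, the signs it prescribes are those of a point. -/
def Realizable [Lattice L] [OrderBot L] (s : (J →₀ k) → L × L) (D : Set (J →₀ k)) : Prop :=
  ∀ P : LatticeHom L Prop, P ⊥ = ⊥ → ∀ A : Finset (J →₀ k), (A : Set (J →₀ k)) ⊆ D →
    (cell P s A).Nonempty

theorem Realizable.mono [Lattice L] [OrderBot L] {s : (J →₀ k) → L × L} {D D' : Set (J →₀ k)}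
    (hs : Realizable s D') (hD : D ⊆ D') : Realizable s D :=
  fun P hP A hA => hs P hP A (hA.trans hD)

variable [IsStrictOrderedRing k]

theorem IsHalfSpaceMap.realizable_signPair [Lattice L] [OrderBot L] {t : (J →₀ k) → L}
    (ht : IsHalfSpaceMap k t) (D : Set (J →₀ k)) : Realizable (signPair t) D := by
  intro P hP A _
  obtain ⟨x, hx⟩ := (ht.comp P hP).exists_point A
  exact ⟨x, fun a ha => (hx a ha).symm⟩

theorem Realizable.isHalfSpaceMap_fst [DistribLattice L] [OrderBot L] {s : (J →₀ k) → L × L}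
    (hs : Realizable s Set.univ) : IsHalfSpaceMap k fun a => (s a).1 := by
  classical
  have point (P : LatticeHom L Prop) (hP : P ⊥ = ⊥) (a b c : J →₀ k) :
      ∃ x, (P (s a).1 ↔ posAt x a) ∧ (P (s b).1 ↔ posAt x b) ∧ (P (s c).1 ↔ posAt x c) := by
    obtain ⟨x, hx⟩ := hs P hP {a, b, c} (Set.subset_univ _)
    have hfst {e} (he : e ∈ ({a, b, c} : Finset (J →₀ k))) : P (s e).1 ↔ posAt x e :=
      Iff.of_eq (congrArg Prod.fst (hx e he)).symm
    exact ⟨x, hfst (by simp), hfst (by simp), hfst (by simp)⟩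
  refine ⟨fun c hc a => eq_of_forall_prop_map_iff fun P hP => ?_,
    fun a b => le_of_forall_prop_map fun P hP => ?_,
    fun a => le_bot_iff.1 (le_of_forall_prop_map fun P hP => ?_)⟩
  · obtain ⟨x, hca, ha, -⟩ := point P hP (c • a) a a
    rw [hca, ha, (isHalfSpaceMap_posAt x).map_smul hc]
  · obtain ⟨x, hab, ha, hb⟩ := point P hP (a + b) a b
    rw [prop_map_sup, hab, ha, hb]
    exact (isHalfSpaceMap_posAt x).pos_or_pos_of_add
  · obtain ⟨x, ha, hna, -⟩ := point P hP a (-a) a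
    rw [prop_map_inf, ha, hna]
    exact fun h => absurd h.2 ((isHalfSpaceMap_posAt x).not_neg h.1)

theorem signPair_posAt_op_smul_add_op_smul {x y a : J →₀ k} {c d : k} (hc : 0 < c) (hd : 0 < d)
    (hpos : posAt y a → posAt x a) (hneg : posAt y (-a) → posAt x (-a)) :
    signPair (posAt (MulOpposite.op c • y + MulOpposite.op d • x)) a = signPair (posAt x) a := by
  have value : linFunctional a (MulOpposite.op c • y + MulOpposite.op d • x) =
      linFunctional a y * c + linFunctional a x * d := by
    rw [linFunctional_add_right, linFunctional_op_smul_right, linFunctional_op_smul_right]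
  rw [posAt_neg, posAt_neg] at hneg
  rw [posAt, posAt] at hpos
  rcases lt_trichotomy (linFunctional a x) 0 with hx | hx | hx
  · have hy : linFunctional a y ≤ 0 := not_lt.1 fun h => lt_asymm hx (hpos h)
    refine (isHalfSpaceMap_posAt _).signPair_eq_of_neg (isHalfSpaceMap_posAt x) ?_
      (posAt_neg.2 hx)
    rw [posAt_neg, value]
    exact add_neg_of_nonpos_of_neg (mul_nonpos_of_nonpos_of_nonneg hy hc.le)
      (mul_neg_of_neg_of_pos hx hd)
  · have hy : linFunctional a y = 0 :=
      le_antisymm (not_lt.1 fun h => (hpos h).ne' hx) (not_lt.1 fun h => (hneg h).ne hx)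
    rw [signPair_posAt_eq_bot hx, signPair_posAt_eq_bot]
    rw [value, hx, hy, zero_mul, zero_mul, add_zero]
  · have hy : 0 ≤ linFunctional a y := not_lt.1 fun h => lt_asymm hx (hneg h)
    refine (isHalfSpaceMap_posAt _).signPair_eq_of_pos (isHalfSpaceMap_posAt x) ?_ hx
    rw [posAt, value]
    exact add_pos_of_nonneg_of_pos (mul_nonneg hy hc.le) (mul_pos hx hd)

section OneStep

variable [Lattice L] {s : (J →₀ k) → L × L} {F : Finset (J →₀ k)}

theorem exists_mem_cell_linFunctional_eq_zero {P : LatticeHom L Prop} {b x y : J →₀ k}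
    (hx : x ∈ cell P s F) (hy : y ∈ cell P s F) (hbx : linFunctional b x ≤ 0)
    (hby : 0 ≤ linFunctional b y) : ∃ z ∈ cell P s F, linFunctional b z = 0 := by
  rcases hbx.eq_or_lt with hbx | hbx
  · exact ⟨x, hx, hbx⟩
  rcases hby.eq_or_lt with hby | hby
  · exact ⟨y, hy, hby.symm⟩
  refine ⟨MulOpposite.op (linFunctional b y)⁻¹ • y + MulOpposite.op (-linFunctional b x)⁻¹ • x,
    fun a ha => ?_, ?_⟩
  · have hsign : signPair (posAt y) a = signPair (posAt x) a := (hy a ha).trans (hx a ha).symm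
    rw [← hx a ha]
    exact signPair_posAt_op_smul_add_op_smul (inv_pos.2 hby) (inv_pos.2 (neg_pos.2 hbx))
      (signPair_eq_iff.1 hsign).1.mp (signPair_eq_iff.1 hsign).2.mp
  · rw [linFunctional_add_right, linFunctional_op_smul_right, linFunctional_op_smul_right,
      mul_inv_cancel₀ hby.ne', inv_neg, mul_neg, mul_inv_cancel₀ hbx.ne, add_neg_cancel]

theorem exists_mem_cell_posAt {P : LatticeHom L Prop} {b x y : J →₀ k} (hx : x ∈ cell P s F)
    (hby : posAt y b) (h : ∀ a ∈ F, (posAt y a → posAt x a) ∧ (posAt y (-a) → posAt x (-a))) :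
    ∃ z ∈ cell P s F, posAt z b := by
  by_cases hbx : posAt x b
  · exact ⟨x, hx, hbx⟩
  let c := (linFunctional b y)⁻¹ * (1 - linFunctional b x)
  have hc : 0 < c := mul_pos (inv_pos.2 hby) (sub_pos.2 ((not_lt.1 hbx).trans_lt one_pos))
  refine ⟨MulOpposite.op c • y + MulOpposite.op (1 : k) • x, fun a ha => ?_, ?_⟩
  · rw [← hx a ha]
    exact signPair_posAt_op_smul_add_op_smul hc one_pos (h a ha).1 (h a ha).2
  · rw [posAt, linFunctional_add_right, linFunctional_op_smul_right, linFunctional_op_smul_right,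
      mul_inv_cancel_left₀ hby.ne', mul_one, sub_add_cancel]
    exact one_pos

theorem exists_mem_cell_linFunctional_nonpos {P : LatticeHom L Prop} {b : J →₀ k} {c d u : L}
    (hcdu : c ≤ u ⊔ d) (hc : (∀ x ∈ cell P s F, posAt x b) → P c)
    (hd : P d → ∃ x ∈ cell P s F, posAt x (-b)) (huc : ¬P (u ⊓ c)) :
    ∃ x ∈ cell P s F, linFunctional b x ≤ 0 := by
  by_contra! hall
  have hPc : P c := hc hall
  rcases (prop_map_sup P u d).1 (OrderHomClass.mono P hcdu hPc) with hPu | hPd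
  · exact huc ((prop_map_inf P u c).2 ⟨hPu, hPc⟩)
  · obtain ⟨x, hx, hbx⟩ := hd hPd
    exact lt_asymm (hall x hx) (posAt_neg.1 hbx)

variable [OrderBot L]

/-- Take for `c` the join, over the points `y` with `0 < b y`, of the meets of the values of the
half-spaces containing `y`. -/
theorem exists_value_of_realizable (hs : Realizable s (F : Set (J →₀ k))) (b : J →₀ k) :
    ∃ c : L, ∀ P : LatticeHom L Prop, P ⊥ = ⊥ →
      (P c → ∃ x ∈ cell P s F, posAt x b) ∧ ((∀ x ∈ cell P s F, posAt x b) → P c) := by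
  classical
  let S : Finset L := F.image (fun a => (s a).1) ∪ F.image (fun a => (s a).2)
  have fst_mem {a} (ha : a ∈ F) : (s a).1 ∈ S :=
    Finset.mem_union_left _ (Finset.mem_image_of_mem (fun a => (s a).1) ha)
  have snd_mem {a} (ha : a ∈ F) : (s a).2 ∈ S :=
    Finset.mem_union_right _ (Finset.mem_image_of_mem (fun a => (s a).2) ha)
  obtain ⟨c, hc⟩ := exists_forall_prop_map_iff S fun σ =>
    ∃ y, posAt y b ∧ ∀ a ∈ F, (posAt y a → (s a).1 ∈ σ) ∧ (posAt y (-a) → (s a).2 ∈ σ)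
  refine ⟨c, fun P hP => ⟨fun hPc => ?_, fun hall => (hc P hP).2 ?_⟩⟩
  · obtain ⟨σ, -, -, ⟨y, hby, hσ⟩, hPσ⟩ := (hc P hP).1 hPc
    obtain ⟨x, hx⟩ := hs P hP F subset_rfl
    refine exists_mem_cell_posAt hx hby fun a ha => ⟨fun hya => ?_, fun hya => ?_⟩
    · exact (congrArg Prod.fst (hx a ha)).mpr (hPσ _ ((hσ a ha).1 hya))
    · exact (congrArg Prod.snd (hx a ha)).mpr (hPσ _ ((hσ a ha).2 hya))
  · obtain ⟨x, hx⟩ := hs P hP F subset_rfl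
    refine ⟨{l ∈ S | P l}, Finset.filter_subset _ _, ?_, ⟨x, hall x hx, fun a ha => ⟨?_, ?_⟩⟩,
      fun l hl => (Finset.mem_filter.1 hl).2⟩
    · by_contra hempty
      have hfalse {l} (hl : l ∈ S) : P l = ⊥ := eq_false fun hPl =>
        hempty ⟨l, Finset.mem_filter.2 ⟨hl, hPl⟩⟩
      have hzero : (0 : J →₀ k) ∈ cell P s F := fun a ha => by
        rw [signPair_posAt_eq_bot (linFunctional_zero_right a)]
        exact Prod.ext (hfalse (fst_mem ha)).symm (hfalse (snd_mem ha)).symm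
      exact (hall 0 hzero).ne' (linFunctional_zero_right b)
    · exact fun hxa => Finset.mem_filter.2 ⟨fst_mem ha, (congrArg Prod.fst (hx a ha)).mp hxa⟩
    · exact fun hxa => Finset.mem_filter.2 ⟨snd_mem ha, (congrArg Prod.snd (hx a ha)).mp hxa⟩

theorem CompletelyNormal.exists_value_pair (hL : CompletelyNormal L)
    (hs : Realizable s (F : Set (J →₀ k))) (b : J →₀ k) :
    ∃ u v : L, ∀ P : LatticeHom L Prop, P ⊥ = ⊥ →
      ∃ x ∈ cell P s F, signPair (posAt x) b = (P u, P v) := by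
  obtain ⟨c, hc⟩ := exists_value_of_realizable hs b
  obtain ⟨d, hd⟩ := exists_value_of_realizable hs (-b)
  obtain ⟨u, v, hu, hv, huv⟩ := hL c d
  refine ⟨u ⊓ c, v ⊓ d, fun P hP => ?_⟩
  have le_map {a b : L} (hab : a ≤ b) : P a → P b := OrderHomClass.mono P hab
  have not_both (hPu : P u) (hPv : P v) : False := by
    have hbot := (prop_map_inf P u v).2 ⟨hPu, hPv⟩
    rwa [huv, hP] at hbot
  by_cases hpos : P (u ⊓ c)
  · have hneg : ¬P (v ⊓ d) := fun h => not_both (le_map inf_le_left hpos) (le_map inf_le_left h)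
    obtain ⟨x, hx, hbx⟩ := (hc P hP).1 (le_map inf_le_right hpos)
    refine ⟨x, hx, Prod.ext (propext (iff_of_true hbx hpos)) (propext (iff_of_false ?_ hneg))⟩
    exact (isHalfSpaceMap_posAt x).not_neg hbx
  by_cases hneg : P (v ⊓ d)
  · obtain ⟨x, hx, hbx⟩ := (hd P hP).1 (le_map inf_le_right hneg)
    refine ⟨x, hx, Prod.ext (propext (iff_of_false ?_ hpos)) (propext (iff_of_true hbx hneg))⟩
    exact fun h => (isHalfSpaceMap_posAt x).not_neg h hbx
  obtain ⟨x, hx, hbx⟩ := exists_mem_cell_linFunctional_nonpos hu (hc P hP).2 (hd P hP).1 hpos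
  obtain ⟨y, hy, hby⟩ := exists_mem_cell_linFunctional_nonpos (hv.trans_eq (sup_comm c v))
    (hd P hP).2 (by rw [neg_neg]; exact (hc P hP).1) hneg
  rw [linFunctional_neg, neg_nonpos] at hby
  obtain ⟨z, hz, hbz⟩ := exists_mem_cell_linFunctional_eq_zero hx hy hbx hby
  refine ⟨z, hz, (signPair_posAt_eq_bot hbz).trans ?_⟩
  exact Prod.ext (eq_false hpos).symm (eq_false hneg).symm

end OneStep

end Cell

section Extension

variable {k J L : Type*} [DivisionRing k] [LinearOrder k] {I : Set J}

section

variable [IsStrictOrderedRing k] [Lattice L] [OrderBot L]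

/-- The signs of a point on `G` constrain its coordinates in `I` only through finitely many
forms `W`. -/
theorem exists_finset_forall_mem_cell_lift (I : Set J) (G : Finset (J →₀ k)) :
    ∃ W : Finset (J →₀ k), (W : Set (J →₀ k)) ⊆ Finsupp.supported k k I ∧
      ∀ s : (J →₀ k) → L × L, Realizable s (Finsupp.supported k k I : Set (J →₀ k)) →
        ∀ P : LatticeHom L Prop, P ⊥ = ⊥ → ∀ x ∈ cell P s W, ∀ B : Finset (J →₀ k),
          (B : Set (J →₀ k)) ⊆ Finsupp.supported k k I →
            ∃ z ∈ cell P s B, ∀ a ∈ G, signPair (posAt z) a = signPair (posAt x) a := by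
  classical
  obtain ⟨W, hW, lift⟩ := exists_finset_supported_lift I G
  refine ⟨W, hW, fun s hs P hP x hx B hB => ?_⟩
  obtain ⟨y, hy⟩ := hs P hP (B ∪ W) (by
    rw [Finset.coe_union]
    exact Set.union_subset hB hW)
  obtain ⟨z, hzy, hzx⟩ := lift (posAt x) (isHalfSpaceMap_posAt x) y fun w hw =>
    (hx w hw).trans (hy w (Finset.mem_union_right B hw)).symm
  refine ⟨z, fun a ha => ?_, fun a ha => (hzx a ha).symm⟩
  rw [signPair_posAt_congr (hB ha) hzy]
  exact hy a (Finset.mem_union_left W ha)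

open Classical in
theorem CompletelyNormal.exists_realizable_update (hL : CompletelyNormal L)
    {s : (J →₀ k) → L × L} {A : Finset (J →₀ k)}
    (hs : Realizable s (Finsupp.supported k k I ∪ A : Set (J →₀ k))) {b : J →₀ k}
    (hb : b ∉ (Finsupp.supported k k I ∪ A : Set (J →₀ k))) :
    ∃ l : L × L, Realizable (Function.update s b l)
      (insert b (Finsupp.supported k k I ∪ A : Set (J →₀ k))) := by
  obtain ⟨W, hW, lift⟩ := exists_finset_forall_mem_cell_lift (L := L) I (insert b A)
  obtain ⟨u, v, huv⟩ := hL.exists_value_pair (F := A ∪ W) (hs.mono (by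
    rw [Finset.coe_union, Set.union_comm]
    exact Set.union_subset_union_left _ hW)) b
  refine ⟨(u, v), fun P hP B hB => ?_⟩
  obtain ⟨x, hx, hxb⟩ := huv P hP
  obtain ⟨z, hz, hzx⟩ := lift s (hs.mono Set.subset_union_left) P hP x
    (fun w hw => hx w (Finset.mem_union_right A hw)) {a ∈ B | a ∈ Finsupp.supported k k I}
    (fun a ha => (Finset.mem_filter.1 ha).2)
  refine ⟨z, fun a ha => ?_⟩
  rcases eq_or_ne a b with rfl | hab
  · rw [Function.update_self, hzx a (Finset.mem_insert_self a A), hxb]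
    rfl
  rw [Function.update_of_ne hab]
  rcases (hB ha).resolve_left hab with haI | haA
  · exact hz a (Finset.mem_filter.2 ⟨ha, haI⟩)
  · rw [hzx a (Finset.mem_insert_of_mem haA)]
    exact hx a (Finset.mem_union_left W haA)

open Classical in
theorem Realizable.update_single {s : (J →₀ k) → L × L} {D : Set (J →₀ k)} (hs : Realizable s D)
    {j : J} (hj : ∀ a ∈ D, a j = 0) (c : L) :
    Realizable (Function.update s (Finsupp.single j 1) (c, ⊥))
      (insert (Finsupp.single j 1) D) := by
  intro P hP B hB
  obtain ⟨x, hx⟩ := hs P hP (B.erase (Finsupp.single j 1)) (by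
    rw [Finset.coe_erase, Set.sdiff_singleton_subset_iff]
    exact hB)
  let r : k := if P c then 1 else 0
  let z := x + Finsupp.single j (r - x j)
  have hzj : linFunctional (Finsupp.single j 1) z = r := by
    rw [linFunctional_single_one, Finsupp.add_apply, Finsupp.single_eq_same, add_sub_cancel]
  refine ⟨z, fun a ha => ?_⟩
  rcases eq_or_ne a (Finsupp.single j 1) with rfl | hab
  · rw [Function.update_self]
    by_cases hc : P c
    · have hpos : posAt z (Finsupp.single j 1) := by
        rw [posAt, hzj, show r = 1 from if_pos hc]
        exact one_pos
      exact Prod.ext (propext (iff_of_true hpos hc))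
        ((eq_false ((isHalfSpaceMap_posAt z).not_neg hpos)).trans hP.symm)
    · rw [signPair_posAt_eq_bot (hzj.trans (if_neg hc))]
      exact Prod.ext (eq_false hc).symm hP.symm
  · rw [Function.update_of_ne hab,
      signPair_posAt_add_single (hj a ((hB ha).resolve_left hab))]
    exact hx a (Finset.mem_erase.2 ⟨hab, ha⟩)

end

variable (k I L) in
/-- A finite stage of the construction: an assignment that is finitely consistent on the forms
supported in `I` together with finitely many other forms. Values outside `domain` are junk. -/
structure PartialAssignment [Lattice L] [OrderBot L] where
  forms : Finset (J →₀ k)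
  val : (J →₀ k) → L × L
  realizable : Realizable val (Finsupp.supported k k I ∪ forms : Set (J →₀ k))

namespace PartialAssignment

section

variable [Lattice L] [OrderBot L]

/-- The forms on which a partial assignment is meaningful. -/
def domain (p : PartialAssignment k L I) : Set (J →₀ k) := Finsupp.supported k k I ∪ p.forms

/-- Partial assignments are ordered by extension. -/
instance : Preorder (PartialAssignment k L I) where
  le p q := p.domain ⊆ q.domain ∧ Set.EqOn q.val p.val p.domain
  le_refl p := ⟨subset_rfl, Set.eqOn_refl p.val p.domain⟩
  le_trans _ _ _ hpq hqr := ⟨hpq.1.trans hqr.1, (hqr.2.mono hpq.1).trans hpq.2⟩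

theorem supported_subset_domain (p : PartialAssignment k L I) :
    (Finsupp.supported k k I : Set (J →₀ k)) ⊆ p.domain :=
  Set.subset_union_left

theorem domain_mono {p q : PartialAssignment k L I} (h : p ≤ q) : p.domain ⊆ q.domain := h.1

theorem eqOn_val {p q : PartialAssignment k L I} (h : p ≤ q) : Set.EqOn q.val p.val p.domain := h.2

theorem exists_le_val_eq_of_realizable_update [DecidableEq (J →₀ k)]
    (p : PartialAssignment k L I) {b : J →₀ k} {l : L × L} (hb : b ∉ p.domain)
    (h : Realizable (Function.update p.val b l) (insert b p.domain)) :
    ∃ q, p ≤ q ∧ b ∈ q.domain ∧ q.val b = l := by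
  have hdomain : (Finsupp.supported k k I ∪ (insert b p.forms : Finset (J →₀ k)) : Set (J →₀ k)) =
      insert b p.domain := by
    rw [Finset.coe_insert, Set.union_insert, domain]
  refine ⟨⟨insert b p.forms, Function.update p.val b l, hdomain ▸ h⟩,
    ⟨(Set.subset_insert b _).trans_eq hdomain.symm, fun a ha => ?_⟩,
    .inr (Finset.mem_insert_self b p.forms), Function.update_self b l p.val⟩
  exact Function.update_of_ne (ne_of_mem_of_not_mem ha hb) l p.val

theorem exists_limit {S : Set (PartialAssignment k L I)} (hne : S.Nonempty)
    (hS : DirectedOn (· ≤ ·) S) :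
    ∃ s : (J →₀ k) → L × L, (∀ p ∈ S, Set.EqOn s p.val p.domain) ∧
      Realizable s (⋃ p ∈ S, p.domain) := by
  classical
  let s (a : J →₀ k) : L × L :=
    if h : ∃ p ∈ S, a ∈ p.domain then h.choose.val a else ⊥
  have hs (p) (hp : p ∈ S) : Set.EqOn s p.val p.domain := by
    intro a ha
    have h : ∃ p ∈ S, a ∈ p.domain := ⟨p, hp, ha⟩
    obtain ⟨r, -, hqr, hpr⟩ := hS _ h.choose_spec.1 p hp
    rw [show s a = h.choose.val a from dif_pos h, ← eqOn_val hqr h.choose_spec.2, eqOn_val hpr ha]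
  refine ⟨s, hs, fun P hP A hA => ?_⟩
  obtain ⟨p, hp, hAp⟩ := DirectedOn.exists_mem_subset_of_finset_subset_biUnion hne
    (hS.mono' fun p _ q _ hpq => domain_mono hpq) hA
  obtain ⟨x, hx⟩ := p.realizable P hP A hAp
  exact ⟨x, fun a ha => (hx a ha).trans (congrArg (Prod.map P P) (hs p hp (hAp ha)).symm)⟩

variable [IsStrictOrderedRing k]

theorem exists_le_mem_domain (hL : CompletelyNormal L) (p : PartialAssignment k L I)
    (b : J →₀ k) : ∃ q, p ≤ q ∧ b ∈ q.domain := by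
  classical
  by_cases hb : b ∈ p.domain
  · exact ⟨p, le_rfl, hb⟩
  obtain ⟨l, hl⟩ := hL.exists_realizable_update p.realizable hb
  obtain ⟨q, hpq, hbq, -⟩ := p.exists_le_val_eq_of_realizable_update hb hl
  exact ⟨q, hpq, hbq⟩

theorem exists_le_val_eq (hI : Iᶜ.Infinite) (p : PartialAssignment k L I) (c : L) :
    ∃ q, p ≤ q ∧ ∃ b ∈ q.domain, (q.val b).1 = c := by
  classical
  obtain ⟨j, hjI, hj⟩ := hI.exists_notMem_finset (p.forms.biUnion Finsupp.support)
  have hzero : ∀ a ∈ p.domain, a j = 0 := by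
    rintro a (ha | ha)
    · exact (Finsupp.mem_supported' k a).1 ha j hjI
    · exact Finsupp.notMem_support_iff.1 fun haj => hj (Finset.mem_biUnion.2 ⟨a, ha, haj⟩)
  have hsingle : Finsupp.single j 1 ∉ p.domain := fun h => by
    simpa only [Finsupp.single_eq_same, one_ne_zero] using hzero _ h
  obtain ⟨q, hpq, hbq, hval⟩ := p.exists_le_val_eq_of_realizable_update hsingle
    (p.realizable.update_single hzero c)
  exact ⟨q, hpq, _, hbq, congrArg Prod.fst hval⟩

end

end PartialAssignment

theorem IsHalfSpaceMap.exists_surjective_extension [IsStrictOrderedRing k] [Countable k]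
    [Countable J] [DistribLattice L] [OrderBot L] [Countable L] (hL : CompletelyNormal L)
    (hI : Iᶜ.Infinite) {t : (J →₀ k) → L} (ht : IsHalfSpaceMap k t) :
    ∃ s : (J →₀ k) → L, IsHalfSpaceMap k s ∧ Function.Surjective s ∧
      Set.EqOn s t (Finsupp.supported k k I) := by
  let p₀ : PartialAssignment k L I := ⟨∅, signPair t, ht.realizable_signPair _⟩
  let goal : (J →₀ k) ⊕ L → Order.Cofinal (PartialAssignment k L I) := Sum.elim
    (fun b => ⟨{q | b ∈ q.domain}, fun p => (p.exists_le_mem_domain hL b).imp fun _ => And.symm⟩)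
    (fun c => ⟨{q | ∃ b ∈ q.domain, (q.val b).1 = c},
      fun p => (p.exists_le_val_eq hI c).imp fun _ => And.symm⟩)
  have := Encodable.ofCountable ((J →₀ k) ⊕ L)
  let S := Order.idealOfCofinals p₀ goal
  have meets (i) : ∃ q ∈ goal i, q ∈ S := Order.cofinal_meets_idealOfCofinals p₀ goal i
  have hp₀ : p₀ ∈ S := Order.mem_idealOfCofinals p₀ goal
  obtain ⟨s, hsS, hs⟩ := PartialAssignment.exists_limit S.nonempty S.directed
  have hunion : (⋃ q ∈ S, q.domain) = Set.univ := Set.eq_univ_of_forall fun b => by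
    obtain ⟨q, hbq, hqS⟩ := meets (.inl b)
    exact Set.mem_biUnion hqS hbq
  refine ⟨fun a => (s a).1, Realizable.isHalfSpaceMap_fst (hunion ▸ hs), fun c => ?_,
    fun a ha => ?_⟩
  · obtain ⟨q, ⟨b, hbq, hbc⟩, hqS⟩ := meets (.inr c)
    exact ⟨b, (congrArg Prod.fst (hsS q hqS hbq)).trans hbc⟩
  · exact congrArg Prod.fst (hsS p₀ hp₀ (p₀.supported_subset_domain ha))

end Extension

section Restriction

variable {k J : Type*} [DivisionRing k] {I : Set J}

theorem mapDomain_subtypeVal_mem_supported (a : I →₀ k) :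
    a.mapDomain Subtype.val ∈ Finsupp.supported k k I :=
  (Finsupp.mem_supported' k _).2 fun _ hj =>
    Finsupp.mapDomain_of_notMem_range _ _ (by simpa only [Subtype.range_coe] using hj)

theorem subtypeDomain_mapDomain_subtypeVal (a : I →₀ k) :
    (a.mapDomain Subtype.val).subtypeDomain (· ∈ I) = a :=
  Finsupp.ext fun i => Finsupp.mapDomain_apply Subtype.val_injective a i

end Restriction

section OpSpace

variable {k J L : Type*} [DivisionRing k] [LinearOrder k] {I : Set J}

theorem eps_halfSpace (a : I →₀ k) :
    eps k I (halfSpace a) = halfSpace (a.mapDomain Subtype.val) :=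
  Subtype.ext <| Set.ext fun x => by
    change 0 < linFunctional a _ ↔ 0 < linFunctional _ x
    rw [linFunctional_mapDomain]

variable [IsStrictOrderedRing k] [Countable k] [Countable J]
  [DistribLattice L] [OrderBot L] [Countable L]

theorem IsHalfSpaceMap.exists_surjective_latticeHom (hL : CompletelyNormal L) (hI : Iᶜ.Infinite)
    {t : (I →₀ k) → L} (ht : IsHalfSpaceMap k t) :
    ∃ g : LatticeHom (OpSpace k J) L, Function.Surjective (g ∘ halfSpace) ∧
      ∀ a, g (halfSpace (a.mapDomain Subtype.val)) = t a := by
  obtain ⟨s, hs, hsurj, hst⟩ :=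
    (ht.comp_linearMap (Finsupp.lsubtypeDomain I)).exists_surjective_extension hL hI
  obtain ⟨g, hg⟩ := hs.exists_latticeHom
  have hgs : g ∘ halfSpace = s := funext hg
  refine ⟨g, hgs ▸ hsurj, fun a => ?_⟩
  rw [hg, hst (mapDomain_subtypeVal_mem_supported a)]
  exact congrArg t (subtypeDomain_mapDomain_subtypeVal a)

theorem OpSpace.exists_surjective_extension (hL : CompletelyNormal L) (hI : Iᶜ.Infinite)
    (f : LatticeHom (OpSpace k I) L) (hf : f ⊥ = ⊥) :
    ∃ g : LatticeHom (OpSpace k J) L, Function.Surjective g ∧ g.comp (eps k I) = f := by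
  obtain ⟨g, hsurj, hg⟩ := (isHalfSpaceMap_halfSpace.comp f hf).exists_surjective_latticeHom hL hI
  refine ⟨g, hsurj.of_comp, latticeHom_ext fun a => ?_⟩
  rw [LatticeHom.comp_apply, eps_halfSpace, hg]
  rfl

end OpSpace

section LatticeOrderedGroup

theorem posPart_sup {V : Type*} [AddGroup V] [Lattice V] (a b : V) : (a ⊔ b)⁺ = a⁺ ⊔ b⁺ :=
  sup_sup_distrib_right a b 0

variable {V : Type*} [AddCommGroup V] [Lattice V] [IsOrderedAddMonoid V]

theorem posPart_inf (a b : V) : (a ⊓ b)⁺ = a⁺ ⊓ b⁺ :=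
  @sup_inf_right _ (AddCommGroup.toDistribLattice V) a b 0

theorem posPart_add_le (a b : V) : (a + b)⁺ ≤ a⁺ + b⁺ :=
  sup_le (add_le_add (le_posPart a) (le_posPart b))
    (add_nonneg (posPart_nonneg a) (posPart_nonneg b))

variable {S : Type*} [SetLike S V] {s : S}

theorem add_mem_latticeClosure [AddMemClass S V] {a b : V} (ha : a ∈ latticeClosure (s : Set V))
    (hb : b ∈ latticeClosure (s : Set V)) : a + b ∈ latticeClosure (s : Set V) := by
  induction ha using latticeClosure_sup_inf_induction with
  | mem a ha =>
    induction hb using latticeClosure_sup_inf_induction with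
    | mem b hb => exact subset_latticeClosure (add_mem ha hb)
    | sup b _ c _ hb hc => exact add_sup b c a ▸ isSublattice_latticeClosure.supClosed hb hc
    | inf b _ c _ hb hc => exact add_inf b c a ▸ isSublattice_latticeClosure.infClosed hb hc
  | sup a _ c _ ha hc => exact sup_add a c b ▸ isSublattice_latticeClosure.supClosed ha hc
  | inf a _ c _ ha hc => exact inf_add a c b ▸ isSublattice_latticeClosure.infClosed ha hc

theorem neg_mem_latticeClosure [NegMemClass S V] {a : V} (ha : a ∈ latticeClosure (s : Set V)) :
    -a ∈ latticeClosure (s : Set V) := by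
  induction ha using latticeClosure_sup_inf_induction with
  | mem a ha => exact subset_latticeClosure (neg_mem ha)
  | sup a _ b _ ha hb => exact neg_sup a b ▸ isSublattice_latticeClosure.infClosed ha hb
  | inf a _ b _ ha hb => exact neg_inf a b ▸ isSublattice_latticeClosure.supClosed ha hb

end LatticeOrderedGroup

namespace VectorLatticeHom

variable {k V W : Type*} [DivisionRing k] [AddCommGroup V] [Lattice V] [Module k V]
  [AddCommGroup W] [Lattice W] [Module k W]

theorem map_sup (h : VectorLatticeHom k V W) (a b : V) :
    h.toLinearMap (a ⊔ b) = h.toLinearMap a ⊔ h.toLinearMap b :=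
  h.map_sup' a b

theorem map_inf (h : VectorLatticeHom k V W) (a b : V) :
    h.toLinearMap (a ⊓ b) = h.toLinearMap a ⊓ h.toLinearMap b :=
  h.map_inf' a b

theorem map_posPart (h : VectorLatticeHom k V W) (a : V) :
    h.toLinearMap a⁺ = (h.toLinearMap a)⁺ := by
  rw [posPart_def, posPart_def, h.map_sup, map_zero]

end VectorLatticeHom

section VectorLattice

variable {k V : Type*} [DivisionRing k] [LinearOrder k] [IsStrictOrderedRing k]
  [AddCommGroup V] [Lattice V] [IsOrderedAddMonoid V] [Module k V] [PosSMulMono k V]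

theorem smul_mem_latticeClosure {S : Submodule k V} (c : k) {a : V}
    (ha : a ∈ latticeClosure (S : Set V)) : c • a ∈ latticeClosure (S : Set V) := by
  wlog hc : 0 ≤ c generalizing c
  · rw [← neg_smul_neg, smul_neg]
    exact neg_mem_latticeClosure (this (-c) (neg_nonneg.2 (le_of_not_ge hc)))
  induction ha using latticeClosure_sup_inf_induction with
  | mem a ha => exact subset_latticeClosure (S.smul_mem c ha)
  | sup a _ b _ ha hb =>
    exact VectorLattice.smul_sup hc a b ▸ isSublattice_latticeClosure.supClosed ha hb
  | inf a _ b _ ha hb =>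
    exact VectorLattice.smul_inf hc a b ▸ isSublattice_latticeClosure.infClosed ha hb

theorem posPart_smul {c : k} (hc : 0 ≤ c) (a : V) : (c • a)⁺ = c • a⁺ := by
  rw [posPart_def, posPart_def, VectorLattice.smul_sup hc, smul_zero]

namespace Idc

theorem mk_mono_of_nonneg {a b : V} (ha : 0 ≤ a) (hab : a ≤ b) : mk k a ≤ mk k b :=
  mk_le_mk.2 ⟨1, zero_le_one, by rwa [one_smul, abs_of_nonneg ha, abs_of_nonneg (ha.trans hab)]⟩

theorem mk_abs (a : V) : mk k |a| = mk k a :=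
  le_antisymm (mk_le_mk.2 ⟨1, zero_le_one, by simp⟩) (mk_le_mk.2 ⟨1, zero_le_one, by simp⟩)

theorem mk_smul {c : k} (hc : c ≠ 0) (a : V) : mk k (c • a) = mk k a :=
  le_antisymm (mk_le_mk.2 ⟨|c|, abs_nonneg c, VectorLattice.abs_smul_le c a⟩)
    (mk_le_mk.2 ⟨|c⁻¹|, abs_nonneg c⁻¹, by
      simpa only [inv_smul_smul₀ hc] using VectorLattice.abs_smul_le c⁻¹ (c • a)⟩)

theorem mk_add_of_nonneg {a b : V} (ha : 0 ≤ a) (hb : 0 ≤ b) :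
    mk k (a + b) = mk k a ⊔ mk k b := by
  rw [mk_sup_mk, abs_of_nonneg ha, abs_of_nonneg hb]

theorem mk_sup_of_nonneg {a b : V} (ha : 0 ≤ a) (hb : 0 ≤ b) :
    mk k (a ⊔ b) = mk k a ⊔ mk k b := by
  refine le_antisymm ?_
    (sup_le (mk_mono_of_nonneg ha le_sup_left) (mk_mono_of_nonneg hb le_sup_right))
  rw [← mk_add_of_nonneg ha hb]
  exact mk_mono_of_nonneg (ha.trans le_sup_left)
    (sup_le (le_add_of_nonneg_right hb) (le_add_of_nonneg_left ha))

theorem mk_inf_of_nonneg {a b : V} (ha : 0 ≤ a) (hb : 0 ≤ b) :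
    mk k (a ⊓ b) = mk k a ⊓ mk k b := by
  rw [mk_inf_mk, abs_of_nonneg ha, abs_of_nonneg hb]

theorem mk_posPart_sup_mk_posPart_neg (a : V) : mk k a⁺ ⊔ mk k (-a)⁺ = mk k a := by
  rw [← mk_add_of_nonneg (posPart_nonneg a) (posPart_nonneg (-a)), ← mk_abs a,
    ← posPart_add_negPart a, posPart_neg]

theorem isHalfSpaceMap_mk_posPart : IsHalfSpaceMap k fun a : V => mk k a⁺ where
  map_smul c hc a := by rw [posPart_smul hc.le, mk_smul hc.ne']
  map_add_le a b := by
    rw [← mk_add_of_nonneg (posPart_nonneg a) (posPart_nonneg b)]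
    exact mk_mono_of_nonneg (posPart_nonneg (a + b)) (posPart_add_le a b)
  map_inf_map_neg a := by
    rw [← mk_inf_of_nonneg (posPart_nonneg a) (posPart_nonneg (-a)), posPart_neg,
      posPart_inf_negPart_eq_zero]
    rfl

end Idc

end VectorLattice

namespace FreeVL

variable {k X : Type*} [DivisionRing k] [LinearOrder k] [IsStrictOrderedRing k]

/-- The embedding of `k^(X)` into the free vector lattice on `X`, sending each basis vector to the
corresponding generator. -/
noncomputable def linear : (X →₀ k) →ₗ[k] FreeVL k X := Finsupp.linearCombination k of

theorem lift_linear (x a : X →₀ k) :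
    (lift (k := k) (x : X → k)).toLinearMap (linear a) = linFunctional a x :=
  Finsupp.apply_linearCombination k _ of a

theorem inclusion_linear {J : Type*} (I : Set J) (a : I →₀ k) :
    (inclusion k I).toLinearMap (linear a) = linear (a.mapDomain Subtype.val) := by
  rw [linear, linear, Finsupp.apply_linearCombination, Finsupp.linearCombination_mapDomain]
  rfl

theorem mem_latticeClosure_range_linear (a : FreeVL k X) :
    a ∈ latticeClosure (LinearMap.range (linear (k := k) (X := X)) : Set (FreeVL k X)) := by
  obtain ⟨t⟩ := a
  induction t with
  | of x => exact subset_latticeClosure ⟨Finsupp.single x 1, by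
      rw [linear, Finsupp.linearCombination_single, one_smul]
      rfl⟩
  | zero => exact subset_latticeClosure ⟨0, map_zero linear⟩
  | add a b ha hb => exact add_mem_latticeClosure ha hb
  | neg a ha => exact neg_mem_latticeClosure ha
  | smul c a ha => exact smul_mem_latticeClosure c ha
  | sup a b ha hb => exact isSublattice_latticeClosure.supClosed ha hb
  | inf a b ha hb => exact isSublattice_latticeClosure.infClosed ha hb

/-- The principal `ℓ`-ideal `⟨a⁺⟩` of a linear element `a` of the free vector lattice, the
counterpart of the open half-space `{x | 0 < a x}`. -/
noncomputable def idealPos (a : X →₀ k) : Idc k (FreeVL k X) := Idc.mk k (linear a)⁺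

theorem isHalfSpaceMap_idealPos :
    IsHalfSpaceMap k (idealPos : (X →₀ k) → Idc k (FreeVL k X)) :=
  (Idc.isHalfSpaceMap_mk_posPart (V := FreeVL k X)).comp_linearMap linear

theorem idc_induction {motive : Idc k (FreeVL k X) → Prop}
    (basic : ∀ a, motive (idealPos a))
    (sup : ∀ S T, motive S → motive T → motive (S ⊔ T))
    (inf : ∀ S T, motive S → motive T → motive (S ⊓ T)) (S : Idc k (FreeVL k X)) : motive S := by
  have mk_posPart (a : FreeVL k X) : motive (Idc.mk k a⁺) := by
    induction mem_latticeClosure_range_linear a using latticeClosure_sup_inf_induction with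
    | mem a ha =>
      obtain ⟨a, rfl⟩ := ha
      exact basic a
    | sup a _ b _ ha hb =>
      rw [posPart_sup, Idc.mk_sup_of_nonneg (posPart_nonneg a) (posPart_nonneg b)]
      exact sup _ _ ha hb
    | inf a _ b _ ha hb =>
      rw [posPart_inf, Idc.mk_inf_of_nonneg (posPart_nonneg a) (posPart_nonneg b)]
      exact inf _ _ ha hb
  obtain ⟨a, rfl⟩ := Idc.exists_mk S
  rw [← Idc.mk_posPart_sup_mk_posPart_neg]
  exact sup _ _ (mk_posPart a) (mk_posPart (-a))

theorem idc_latticeHom_ext {M : Type*} [Lattice M] {f g : LatticeHom (Idc k (FreeVL k X)) M}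
    (h : ∀ a, f (idealPos a) = g (idealPos a)) : f = g := by
  refine LatticeHom.ext fun S => ?_
  induction S using idc_induction with
  | basic a => exact h a
  | sup S T hS hT => rw [map_sup, map_sup, hS, hT]
  | inf S T hS hT => rw [map_inf, map_inf, hS, hT]

theorem eta_idealPos {J : Type*} (I : Set J) (a : I →₀ k) :
    eta k I (idealPos a) = idealPos (a.mapDomain Subtype.val) := by
  rw [eta, idealPos, idcMap_mk, VectorLatticeHom.map_posPart, inclusion_linear, idealPos]

/-- The set of points of `k^(X)` where some element of a principal `ℓ`-ideal of the free vector
lattice, regarded as a function on `k^(X)`, does not vanish. -/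
def cozeroSet (S : Idc k (FreeVL k X)) : Set (X →₀ k) :=
  {x | ∃ a ∈ (S : Submodule k (FreeVL k X)), (lift (k := k) (x : X → k)).toLinearMap a ≠ 0}

theorem mem_cozeroSet_mk {a : FreeVL k X} {x : X →₀ k} :
    x ∈ cozeroSet (Idc.mk k a) ↔ 0 < |(lift (k := k) (x : X → k)).toLinearMap a| := by
  rw [abs_pos]
  refine ⟨?_, fun h => ⟨a, self_mem_principalLIdeal a, h⟩⟩
  rintro ⟨b, ⟨c, -, hb⟩, hne⟩ ha
  have hle := (lift (k := k) (x : X → k)).mono hb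
  rw [map_smul, VectorLatticeHom.map_abs, VectorLatticeHom.map_abs, ha, abs_zero, smul_zero] at hle
  exact hne (abs_nonpos_iff.1 hle)

theorem cozeroSet_sup (S T : Idc k (FreeVL k X)) :
    cozeroSet (S ⊔ T) = cozeroSet S ∪ cozeroSet T := by
  obtain ⟨a, rfl⟩ := Idc.exists_mk S
  obtain ⟨b, rfl⟩ := Idc.exists_mk T
  ext x
  rw [← Idc.mk_abs a, ← Idc.mk_abs b, ← Idc.mk_sup_of_nonneg (abs_nonneg a) (abs_nonneg b)]
  simp only [Set.mem_union, mem_cozeroSet_mk, VectorLatticeHom.map_sup, VectorLatticeHom.map_abs,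
    abs_abs, abs_of_nonneg (le_sup_of_le_left (abs_nonneg _)), lt_sup_iff]

theorem cozeroSet_inf (S T : Idc k (FreeVL k X)) :
    cozeroSet (S ⊓ T) = cozeroSet S ∩ cozeroSet T := by
  obtain ⟨a, rfl⟩ := Idc.exists_mk S
  obtain ⟨b, rfl⟩ := Idc.exists_mk T
  ext x
  simp only [Idc.mk_inf_mk, Set.mem_inter_iff, mem_cozeroSet_mk, VectorLatticeHom.map_inf,
    VectorLatticeHom.map_abs, abs_of_nonneg (le_inf (abs_nonneg _) (abs_nonneg _)), lt_inf_iff]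

theorem cozeroSet_idealPos (a : X →₀ k) : cozeroSet (idealPos a) = halfSpace a := by
  ext x
  rw [idealPos, mem_cozeroSet_mk, VectorLatticeHom.map_posPart, lift_linear,
    abs_of_nonneg (posPart_nonneg _), posPart_pos_iff, mem_halfSpace, posAt]

theorem cozeroSet_mem_opSpace (S : Idc k (FreeVL k X)) : cozeroSet S ∈ OpSpace k X := by
  induction S using idc_induction with
  | basic a => exact cozeroSet_idealPos a ▸ (halfSpace a).2
  | sup S T hS hT => exact cozeroSet_sup S T ▸ (OpSpace k X).sup_mem hS hT
  | inf S T hS hT => exact cozeroSet_inf S T ▸ (OpSpace k X).inf_mem hS hT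

variable (k X) in
/-- The canonical homomorphism from `Id_c F_ℓ(X, k)` to `Op⁻(k^(X), k^(X))`. -/
def cozeroHom : LatticeHom (Idc k (FreeVL k X)) (OpSpace k X) where
  toFun S := ⟨cozeroSet S, cozeroSet_mem_opSpace S⟩
  map_sup' S T := Subtype.ext (cozeroSet_sup S T)
  map_inf' S T := Subtype.ext (cozeroSet_inf S T)

theorem cozeroHom_idealPos (a : X →₀ k) : cozeroHom k X (idealPos a) = halfSpace a :=
  Subtype.ext (cozeroSet_idealPos a)

theorem idc_exists_surjective_extension [Countable k] {J : Type*} [Countable J] {I : Set J}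
    {L : Type*} [DistribLattice L] [OrderBot L] [Countable L] (hL : CompletelyNormal L)
    (hI : Iᶜ.Infinite) (f : LatticeHom (Idc k (FreeVL k I)) L) (hf : f ⊥ = ⊥) :
    ∃ g : LatticeHom (Idc k (FreeVL k J)) L, Function.Surjective g ∧ g.comp (eta k I) = f := by
  obtain ⟨g, hsurj, hg⟩ := (isHalfSpaceMap_idealPos.comp f hf).exists_surjective_latticeHom hL hI
  have hgc : ⇑(g.comp (cozeroHom k J)) ∘ idealPos = g ∘ halfSpace :=
    funext fun a => congrArg g (cozeroHom_idealPos a)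
  refine ⟨g.comp (cozeroHom k J), (hgc ▸ hsurj).of_comp, idc_latticeHom_ext fun a => ?_⟩
  rw [LatticeHom.comp_apply, LatticeHom.comp_apply, eta_idealPos, cozeroHom_idealPos, hg]
  rfl

end FreeVL

theorem theoremT_general
    {k : Type*} [DivisionRing k] [LinearOrder k] [IsStrictOrderedRing k] [Countable k]
    {J : Type*} [Countable J] (I : Set J) (hI : (Iᶜ : Set J).Infinite) {K : Type*} [Lattice K]
    {L : Type*} [DistribLattice L] [OrderBot L] [Countable L] (hL : CompletelyNormal L)
    (φ : LatticeHom K L) :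
    (∀ f : LatticeHom (OpSpace k I) K, φ (f ⊥) = ⊥ →
      ∃ g : LatticeHom (OpSpace k J) L,
        Function.Surjective g ∧ g.comp (eps k I) = φ.comp f) ∧
    (∀ f : LatticeHom (Idc k (FreeVL k I)) K, φ (f ⊥) = ⊥ →
      ∃ g : LatticeHom (Idc k (FreeVL k J)) L,
        Function.Surjective g ∧ g.comp (eta k I) = φ.comp f) :=
  ⟨fun f => OpSpace.exists_surjective_extension hL hI (φ.comp f),
    fun f => FreeVL.idc_exists_surjective_extension hL hI (φ.comp f)⟩

theorem theoremT
    {k : Type*} [DivisionRing k] [LinearOrder k] [IsStrictOrderedRing k] [Countable k]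
    {J : Type*} [Countable J] (I : Set J) (hI : (Iᶜ : Set J).Infinite)
    {K : Type*} [DistribLattice K] [OrderBot K]
    {L : Type*} [DistribLattice L] [OrderBot L] [Countable L] (hL : CompletelyNormal L)
    (φ : LatticeHom K L) (hφ : φ ⊥ = ⊥) :
    (∀ f : LatticeHom (OpSpace k I) K, f ⊥ = ⊥ →
      ∃ g : LatticeHom (OpSpace k J) L,
        Function.Surjective g ∧ g.comp (eps k I) = φ.comp f) ∧
    (∀ f : LatticeHom (Idc k (FreeVL k I)) K, f ⊥ = ⊥ →
      ∃ g : LatticeHom (Idc k (FreeVL k J)) L,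
        Function.Surjective g ∧ g.comp (eta k I) = φ.comp f) :=
  ⟨fun f hf => (theoremT_general I hI hL φ).1 f (by rw [hf, hφ]),
    fun f hf => (theoremT_general I hI hL φ).2 f (by rw [hf, hφ])⟩
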